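/- For a positive integer $m$ let $[m]=\{1<\dots<m\}$ and let $\overline{[m]}=\{\overline 1<\dots<\overline m\}$ be a copy of it; order $[m]\cup\overline{[m]}$ by $1<\overline 1<2<\overline 2<\dots<m<\overline m$. A partition of a totally ordered finite set is non-crossing if, whenever $a<b<c<d$, $a$ and $c$ lie in one block and $b$ and $d$ lie in one block, then $a$ and $b$ lie in the same block. Let $NC^{(A)}(m)$ be the set of non-crossing partitions of $[m]$. For $p\in NC^{(A)}(m)$, the Kreweras complement $\mathrm{Kr}(p)$ is the greatest partition $q$ of $\overline{[m]}$ (where $q\preceq q'$ means that every block of $q$ is contained in a block of $q'$) such that $p\cup q$ is a non-crossing partition of $[m]\cup\overline{[m]}$. The blocks of a non-crossing partition are totally ordered by: $V\sqsubset W$ if either $\min W<\min V\le\max V<\max W$ or $\max V<\min W$. Let $n\ge 1$ and $k\ge 0$ be integers. Let $\mathrm{Red}:[(k+1)n]\to[n]$ send each integer to its congruence class mod $n$, extend it by $\mathrm{Red}(\overline x)=\overline{\mathrm{Red}(x)}$, and apply it to sets elementwise and to families of sets by taking the family of images. Let $NC^{(k)}(n)$ be the set of those $\pi\in NC^{(A)}((k+1)n)$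 such that $\mathrm{Red}(\pi)$ is a non-crossing partition of $[n]$ (the reduction of $\pi$) and $\mathrm{Red}(\mathrm{Kr}(\pi))$ is a non-crossing partition of $\overline{[n]}$. For such $\pi$, the family $\mathrm{Red}(\pi\cup\mathrm{Kr}(\pi))$ is a non-crossing partition of $[n]\cup\overline{[n]}$ with $n+1$ blocks; let $M_1\sqsubset\dots\sqsubset M_{n+1}$ be these blocks. The shape of $\pi$ is the vector $\lambda_\pi$ with coordinates $$(\lambda_\pi)_i=\sum_{V}\Bigl(\frac{\mathrm{card}(V)}{\mathrm{card}(\mathrm{Red}(V))}-1\Bigr),\qquad 1\le i\le n+1,$$ where $V$ runs over the blocks of $\pi\cup\mathrm{Kr}(\pi)$ with $\mathrm{Red}(V)=M_i$. Let $\Lambda_{n+1,k}$ be the set of $\lambda\in\mathbb N^{n+1}$ with $\sum_{j=1}^{n+1}\lambda_j=k$ (where $0\in\mathbb N$). **Proposition.** Let $\lambda\in\Lambda_{n+1,k}$. There is a number $r(\lambda)$ such that, for every $p\in NC^{(A)}(n)$, the number of $\pi\in NC^{(k)}(n)$ having shape $\lambda$ and reduction $p$ equals $r(\lambda)$; that is,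 this number is the same for every choice of $p\in NC^{(A)}(n)$. -/

import Mathlib

namespace NonCrossingTypeK

/-- Two points are linked in a family of blocks when some block contains both. -/
def Linked {α : Type*} (F : Finset (Finset α)) (a b : α) : Prop :=
  ∃ V ∈ F, a ∈ V ∧ b ∈ V

/-- A family of blocks in a totally ordered set is non-crossing when `a < b < c < d`, `a` linked to
`c` and `b` linked to `d` force `a` linked to `b`. -/
def NonCrossing {α : Type*} [LinearOrder α] (F : Finset (Finset α)) : Prop :=
  ∀ a b c d : α, a < b → b < c → c < d → Linked F a c → Linked F b d → Linked F a b

/-- Partitions of `[m]`; the set `{1, …, m}` is modelled by `Fin m`, the point `i` being `i - 1`.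
The order of `Finpartition` is the reverse refinement order. -/
abbrev Part (m : ℕ) : Type := Finpartition (Finset.univ : Finset (Fin m))

/-- The non-crossing partitions of `[m]`. -/
def NC (m : ℕ) : Type := {p : Part m // NonCrossing p.parts}

/-- `[m] ∪ [m]‾` with the order `1 < 1‾ < 2 < 2‾ < ⋯ < m < m‾`. -/
abbrev Doubled (m : ℕ) : Type := Fin m ×ₗ Bool

/-- The point `i` of `[m] ∪ [m]‾`. -/
def plain {m : ℕ} (i : Fin m) : Doubled m := toLex (i, false)

/-- The point `i‾` of `[m] ∪ [m]‾`. -/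
def bar {m : ℕ} (i : Fin m) : Doubled m := toLex (i, true)

/-- The blocks of `p ∪ q`, for a partition `p` of `[m]` and a partition `q` of `[m]‾`
(the latter given as a partition of `[m]`). -/
def blocksUnion {m : ℕ} (p q : Part m) : Finset (Finset (Doubled m)) :=
  p.parts.image (Finset.image plain) ∪ q.parts.image (Finset.image bar)

section Kreweras

variable {m : ℕ}

theorem linked_plain_plain (p q : Part m) (i j : Fin m) :
    Linked (blocksUnion p q) (plain i) (plain j) ↔ Linked p.parts i j := by
  simp [Linked, blocksUnion, plain, bar, or_and_right, exists_or]

theorem linked_bar_bar (p q : Part m) (i j : Fin m) :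
    Linked (blocksUnion p q) (bar i) (bar j) ↔ Linked q.parts i j := by
  simp [Linked, blocksUnion, plain, bar, or_and_right, exists_or]

theorem not_linked_plain_bar (p q : Part m) (i j : Fin m) :
    ¬ Linked (blocksUnion p q) (plain i) (bar j) := by
  simp [Linked, blocksUnion, plain, bar, or_and_right, exists_or]

theorem not_linked_bar_plain (p q : Part m) (i j : Fin m) :
    ¬ Linked (blocksUnion p q) (bar i) (plain j) := by
  simp [Linked, blocksUnion, plain, bar, or_and_right, exists_or]

theorem plain_lt_plain (i j : Fin m) : plain i < plain j ↔ i < j := by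
  simp [plain, Prod.Lex.toLex_lt_toLex]

theorem bar_lt_bar (i j : Fin m) : bar i < bar j ↔ i < j := by
  simp [bar, Prod.Lex.toLex_lt_toLex]

theorem plain_lt_bar (i j : Fin m) : plain i < bar j ↔ i ≤ j := by
  simp [plain, bar, Prod.Lex.toLex_lt_toLex, le_iff_lt_or_eq]

theorem bar_lt_plain (i j : Fin m) : bar i < plain j ↔ i < j := by
  simp [plain, bar, Prod.Lex.toLex_lt_toLex]

theorem plain_or_bar (x : Doubled m) : (∃ i, x = plain i) ∨ ∃ i, x = bar i := by
  rcases x with ⟨i, b⟩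
  cases b
  · exact Or.inl ⟨i, rfl⟩
  · exact Or.inr ⟨i, rfl⟩

/-- `i‾` and `j‾` are not separated by a block of `p`. -/
def krSetoid (p : Part m) : Setoid (Fin m) where
  r i j := ∀ a b, Linked p.parts a b → ((a ≤ i ↔ a ≤ j) ↔ (b ≤ i ↔ b ≤ j))
  iseqv := by
    refine ⟨?_, ?_, ?_⟩
    · intro i a b _
      tauto
    · intro i j h a b hab
      have := h a b hab
      tauto
    · intro i j l h h' a b hab
      have h1 := h a b hab
      have h2 := h' a b hab
      tauto

theorem linked_symm {α : Type*} {F : Finset (Finset α)} {a b : α} (h : Linked F a b) :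
    Linked F b a := by
  obtain ⟨V, hV, ha, hb⟩ := h
  exact ⟨V, hV, hb, ha⟩

open Classical in
theorem linked_ofSetoid (s : Setoid (Fin m)) (i j : Fin m) :
    Linked (Finpartition.ofSetoid s).parts i j ↔ s i j := by
  constructor
  · rintro ⟨V, hV, hi, hj⟩
    have h1 := (Finpartition.ofSetoid s).part_eq_of_mem hV hi
    rw [← h1] at hj
    exact (Finpartition.mem_part_ofSetoid_iff_rel (s := s)).1 hj
  · intro h
    exact ⟨(Finpartition.ofSetoid s).part i,
      (Finpartition.ofSetoid s).part_mem.2 (Finset.mem_univ _),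
      (Finpartition.ofSetoid s).mem_part (Finset.mem_univ _),
      (Finpartition.mem_part_ofSetoid_iff_rel (s := s)).2 h⟩

theorem exists_kreweras (p : NC m) :
    ∃ q : Part m, IsGreatest {q : Part m | NonCrossing (blocksUnion p.1 q)} q := by
  classical
  refine ⟨Finpartition.ofSetoid (krSetoid p.1), ?_, ?_⟩
  · intro a b c d hab hbc hcd hac hbd
    rcases plain_or_bar a with ⟨a, rfl⟩ | ⟨a, rfl⟩ <;>
    rcases plain_or_bar b with ⟨b, rfl⟩ | ⟨b, rfl⟩ <;>
    rcases plain_or_bar c with ⟨c, rfl⟩ | ⟨c, rfl⟩ <;>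
    rcases plain_or_bar d with ⟨d, rfl⟩ | ⟨d, rfl⟩ <;>
    simp only [linked_plain_plain, linked_bar_bar, not_linked_plain_bar, not_linked_bar_plain,
      plain_lt_plain, bar_lt_bar, plain_lt_bar, bar_lt_plain, linked_ofSetoid]
      at hab hbc hcd hac hbd ⊢
    · exact p.2 a b c d hab hbc hcd hac hbd
    · have := hbd a c hac
      grind
    · have := hac b d hbd
      grind
    · intro x y hxy
      have h1 := hac x y hxy
      have h2 := hbd x y hxy
      grind
  · intro q hq V hV
    obtain ⟨i, hi⟩ := q.nonempty_of_mem_parts hV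
    have key : ∀ i j x y, i < j → Linked q.parts i j → Linked p.1.parts x y →
        i < x → x ≤ j → i < y ∧ y ≤ j := by
      intro i j x y hij hl hxy h1 h2
      by_contra hcon
      rcases le_or_gt y i with h | h
      · exact not_linked_plain_bar p.1 q y i (hq (plain y) (bar i) (plain x) (bar j)
          ((plain_lt_bar _ _).2 h) ((bar_lt_plain _ _).2 h1) ((plain_lt_bar _ _).2 h2)
          ((linked_plain_plain _ _ _ _).2 (linked_symm hxy)) ((linked_bar_bar _ _ _ _).2 hl))
      · have h' : j < y := lt_of_not_ge fun h'' => hcon ⟨h, h''⟩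
        exact not_linked_bar_plain p.1 q i x (hq (bar i) (plain x) (bar j) (plain y)
          ((bar_lt_plain _ _).2 h1) ((plain_lt_bar _ _).2 h2) ((bar_lt_plain _ _).2 h')
          ((linked_bar_bar _ _ _ _).2 hl) ((linked_plain_plain _ _ _ _).2 hxy))
    refine ⟨(Finpartition.ofSetoid (krSetoid p.1)).part i,
      (Finpartition.ofSetoid (krSetoid p.1)).part_mem.2 (Finset.mem_univ _), ?_⟩
    intro j hj
    rw [Finpartition.mem_part_ofSetoid_iff_rel]
    intro x y hxy
    rcases lt_trichotomy i j with h | h | h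
    · have h1 := key i j x y h ⟨V, hV, hi, hj⟩ hxy
      have h2 := key i j y x h ⟨V, hV, hi, hj⟩ (linked_symm hxy)
      grind
    · subst h
      tauto
    · have h1 := key j i x y h ⟨V, hV, hj, hi⟩ hxy
      have h2 := key j i y x h ⟨V, hV, hj, hi⟩ (linked_symm hxy)
      grind

/-- The Kreweras complement of `p`: the greatest partition `q` of `[m]‾` such that `p ∪ q` is
non-crossing. -/
noncomputable def kreweras (p : NC m) : Part m := (exists_kreweras p).choose

theorem kreweras_isGreatest (p : NC m) :
    IsGreatest {q : Part m | NonCrossing (blocksUnion p.1 q)} (kreweras p) :=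
  (exists_kreweras p).choose_spec

/-- The blocks of `p ∪ Kr(p)`. -/
noncomputable def mixBlocks (p : NC m) : Finset (Finset (Doubled m)) :=
  blocksUnion p.1 (kreweras p)

end Kreweras

/-- The total order on (non-empty) blocks: `V` is nested in `W`
(`min W < min V` and `max V < max W`) or `V` is on the left of `W` (`max V < min W`). -/
def BlockLT {α : Type*} [LinearOrder α] (V W : Finset α) : Prop :=
  ((∃ w ∈ W, ∀ v ∈ V, w < v) ∧ (∃ w ∈ W, ∀ v ∈ V, v < w)) ∨ (∀ v ∈ V, ∀ w ∈ W, v < w)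

open Classical in
/-- `V` is the block number `i` of the family `F` in the increasing order `BlockLT`,
counting from `0`. -/
def IsNthBlock {α : Type*} [LinearOrder α] (F : Finset (Finset α)) (i : ℕ) (V : Finset α) : Prop :=
  V ∈ F ∧ (F.filter fun W => BlockLT W V).card = i

/-- The reduction mod `n` map from `[(k+1)n]` to `[n]`. -/
def red (k n : ℕ) (x : Fin ((k + 1) * n)) : Fin n := x.modNat

/-- Its extension to `[(k+1)n] ∪ [(k+1)n]‾`, sending `x‾` to the bar of the reduction of `x`. -/
def redDoubled (k n : ℕ) (x : Doubled ((k + 1) * n)) : Doubled n :=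
  toLex (red k n (ofLex x).1, (ofLex x).2)

/-- The family of images of the blocks of `π` under the reduction mod `n`. -/
def redBlocks (k n : ℕ) (π : Part ((k + 1) * n)) : Finset (Finset (Fin n)) :=
  π.parts.image (Finset.image (red k n))

/-- The family `F` is (the set of blocks of) a non-crossing partition of `[n]`. -/
def IsNCPartition {n : ℕ} (F : Finset (Finset (Fin n))) : Prop :=
  ∃ p : NC n, p.1.parts = F

/-- The non-crossing partitions of type `k`: the non-crossing partitions `π` of `[(k+1)n]` such
that the reductions mod `n` of `π` and of `Kr(π)` are non-crossing partitions. -/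
def NCType (k n : ℕ) : Type :=
  {π : NC ((k + 1) * n) //
    IsNCPartition (redBlocks k n π.1) ∧ IsNCPartition (redBlocks k n (kreweras π))}

/-- The type `k` non-crossing partition `π` has reduction `p`. -/
def HasReduction {k n : ℕ} (π : NCType k n) (p : NC n) : Prop :=
  redBlocks k n π.1.1 = p.1.parts

/-- The multiplicity of a block `V`: the quotient `card V / card (Red V)`, as a rational number. -/
def mult {k n : ℕ} (V : Finset (Doubled ((k + 1) * n))) : ℚ :=
  (V.card : ℚ) / ((V.image (redDoubled k n)).card : ℚ)

open Classical in
/-- The shape of `π`: its `i`-th coordinate is the sum of `mult V - 1` over the blocks `V` of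
`π ∪ Kr(π)` that reduce to the `i`-th block of the reduction of `π ∪ Kr(π)`. -/
noncomputable def shape {k n : ℕ} (π : NCType k n) (i : Fin (n + 1)) : ℚ :=
  ∑ V ∈ (mixBlocks π.1).filter fun V =>
    IsNthBlock ((mixBlocks π.1).image (Finset.image (redDoubled k n))) i
      (V.image (redDoubled k n)),
    (mult V - 1)

/-- The vectors of `m` natural numbers with sum `k`. -/
def Lam (m k : ℕ) : Set (Fin m → ℕ) := {l | ∑ j, l j = k}

/-- The set of type `k` non-crossing partitions with shape `l` and reduction `p`. -/
def withShapeAndReduction {k n : ℕ} (l : Fin (n + 1) → ℕ) (p : NC n) : Set (NCType k n) :=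
  {π | (∀ i, shape π i = (l i : ℚ)) ∧ HasReduction π p}

end NonCrossingTypeK

/-! A non-crossing partition `p` is encoded by its cyclic successor permutation `s`, and its
Kreweras complement `q` by `t`, with `s * t` the long cycle. Such pairs are recognised by an Euler
characteristic argument in linear algebra: the functions constant on blocks of `p` and those
constant on blocks of `q` share only the constants, so for `m > 0` the two block counts sum to at
most `m + 1`, with equality exactly when the two spaces span everything (`Planar.card_add_card`,
`planar_of_card`).

A type `k` partition with reduction `p` is then a `(k + 1)`-sheeted lift of the pair `(s, t)`
(`red_perm_apply`). Number the `n + 1` blocks of `p ∪ Kr(p)` from `0` by increasing maximum, which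
is the order of blocks in the theorem (`OrbitFamily.blockLT_iff`). Lifts correspond to sequences `P
0 = 1, P 1, …, P n, P (n + 1)` of permutations of the `k + 1` sheets, the last being the long cycle
(`leftLift_injective`, `exists_leftLift`). The quotient `P (j + 1) * (P j)⁻¹` is the monodromy
around block `j`, and the blocks lying over block `j` are its orbits, so the `j`-th shape coordinate
is `k + 1` minus the number of these orbits (`shape_eq`).

Partitions with given shape and reduction thus biject with factorisations of the long cycle of `[k +
1]` into `n + 1` factors with prescribed numbers of orbits, a set that does not involve `p`.
Conversely, a shape of sum `k` gives the lift enough blocks to be non-crossing. -/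

namespace NonCrossingTypeK

open Equiv Finset

/-! ### Cyclic successors and orbit relations. -/

section Next

variable {α : Type*} [LinearOrder α]

/-- `y` is the cyclic successor of `i` in the class of `i` for the relation `R`. -/
def IsNext (R : α → α → Prop) (i y : α) : Prop :=
  R i y ∧ ((i < y ∧ ∀ j, R i j → i < j → y ≤ j) ∨ ∀ j, R i j → y ≤ j ∧ j ≤ i)

theorem IsNext.eq {R : α → α → Prop} {i y z : α} (hy : IsNext R i y)
    (hz : IsNext R i z) : y = z := by
  obtain ⟨hy, h | h⟩ := hy <;> obtain ⟨hz, h' | h'⟩ := hz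
  · exact le_antisymm (h.2 _ hz h'.1) (h'.2 _ hy h.1)
  · exact absurd h.1 (not_lt.2 (h' _ hy).2)
  · exact absurd h'.1 (not_lt.2 (h _ hz).2)
  · exact le_antisymm (h _ hz).1 (h' _ hy).1

theorem exists_isNext [Finite α] {R : α → α → Prop} (hR : Equivalence R) (i : α) :
    ∃ y, IsNext R i y := by
  classical
  cases nonempty_fintype α
  by_cases h : (univ.filter fun j => R i j ∧ i < j).Nonempty
  · have hm := min'_mem _ h
    simp only [mem_filter, mem_univ, true_and] at hm
    refine ⟨_, hm.1, Or.inl ⟨hm.2, fun j hj hij => min'_le _ _ ?_⟩⟩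
    simp [hj, hij]
  · have h' : (univ.filter fun j => R i j).Nonempty := ⟨i, by simp [hR.refl i]⟩
    have hm := min'_mem _ h'
    simp only [mem_filter, mem_univ, true_and] at hm
    refine ⟨_, hm, Or.inr fun j hj => ⟨min'_le _ _ (by simp [hj]), ?_⟩⟩
    by_contra hc
    exact h ⟨j, by simp [hj, not_le.1 hc]⟩

theorem isNext_injective {R : α → α → Prop} (hR : Equivalence R) {i i' y : α}
    (h : IsNext R i y) (h' : IsNext R i' y) : i = i' := by
  have key : ∀ i i' : α, IsNext R i y → IsNext R i' y → ¬ i < i' := by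
    intro i i' h h' hlt
    have hii : R i i' := hR.trans h.1 (hR.symm h'.1)
    obtain ⟨hy, h | h⟩ := h
    · have h1 := h.2 _ hii hlt
      obtain ⟨hy', h' | h'⟩ := h'
      · exact absurd h'.1 (not_lt.2 h1)
      · exact absurd (h' i (hR.symm hii)).1 (not_le.2 h.1)
    · exact absurd (h _ hii).2 (not_le.2 hlt)
  exact le_antisymm (not_lt.1 (key _ _ h' h)) (not_lt.1 (key _ _ h h'))

theorem sameCycle_imp {α : Type*} [Finite α] {R : α → α → Prop} (hR : Equivalence R)
    {s : Perm α} (hs : ∀ i, R i (s i)) {i j : α} (h : s.SameCycle i j) : R i j := by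
  obtain ⟨k, -, rfl⟩ := h.exists_pow_eq'
  clear h
  induction k with
  | zero => exact hR.refl i
  | succ k ih => rw [pow_succ', Perm.mul_apply]; exact hR.trans ih (hs _)

theorem apply_eq_of_sameCycle {α β : Type*} [Finite α] {s : Perm α} {f : α → β}
    (hf : ∀ i, f (s i) = f i) {i j : α} (h : s.SameCycle i j) : f i = f j :=
  sameCycle_imp (R := fun i j => f i = f j) ⟨fun _ => rfl, Eq.symm, Eq.trans⟩
    (fun i => (hf i).symm) h

theorem sameCycle_map {α β : Type*} [Finite α] {σ : Perm α} {s : Perm β} {r : α → β}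
    (hr : ∀ x, r (σ x) = s (r x)) {x y : α} (h : σ.SameCycle x y) : s.SameCycle (r x) (r y) :=
  sameCycle_imp (R := fun x y => s.SameCycle (r x) (r y))
    ⟨fun _ => .rfl, fun h => h.symm, fun h h' => h.trans h'⟩
    (fun x => by rw [hr]; exact Perm.sameCycle_apply_right.2 .rfl) h

/-- A finite equivalence relation is the orbit relation of its cyclic successor permutation. -/
theorem exists_next_perm [Finite α] {R : α → α → Prop} (hR : Equivalence R) :
    ∃ s : Perm α, (∀ i, IsNext R i (s i)) ∧ ∀ i j, R i j ↔ s.SameCycle i j := by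
  choose f hf using exists_isNext hR
  have hinj : Function.Injective f := fun i j h => isNext_injective hR (hf i) (h ▸ hf j)
  refine ⟨ofBijective f (Finite.injective_iff_bijective.1 hinj), hf, fun i j => ?_⟩
  set s : Perm α := ofBijective f (Finite.injective_iff_bijective.1 hinj) with hs
  have hsf : ∀ i, IsNext R i (s i) := hf
  refine ⟨fun h => ?_, fun h => sameCycle_imp hR (fun i => (hf i).1) h⟩
  -- Repeated successors starting from `i` climb through the class without skipping a member, so
  -- they reach every later `j`.
  have up : ∀ j i : α, R i j → i ≤ j → s.SameCycle i j := by
    intro j i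
    induction i using WellFoundedGT.induction with
    | ind i ih =>
      intro hij hle
      rcases hle.eq_or_lt with rfl | hlt
      · exact .rfl
      · obtain ⟨h1, h2 | h2⟩ := hsf i
        · exact Perm.sameCycle_apply_left.1
            (ih _ h2.1 (hR.trans (hR.symm h1) hij) (h2.2 _ hij hlt))
        · exact absurd (h2 _ hij).2 (not_le.2 hlt)
  rcases le_total i j with h' | h'
  · exact up _ _ h h'
  · exact (up _ _ (hR.symm h) h').symm

end Next

/-! ### Partitions as equivalence relations, and the rotation. -/

theorem linked_equivalence {m : ℕ} (p : Part m) : Equivalence (Linked p.parts) where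
  refl i := by
    obtain ⟨V, hV, hi⟩ := p.exists_mem (mem_univ i)
    exact ⟨V, hV, hi, hi⟩
  symm := linked_symm
  trans := by
    rintro a b c ⟨V, hV, ha, hb⟩ ⟨W, hW, hb', hc⟩
    have := p.eq_of_mem_parts hV hW hb hb'
    subst this
    exact ⟨V, hV, ha, hc⟩

theorem mem_of_linked {m : ℕ} {p : Part m} {V : Finset (Fin m)} (hV : V ∈ p.parts) {i j : Fin m}
    (hi : i ∈ V) (h : Linked p.parts i j) : j ∈ V := by
  obtain ⟨W, hW, hi', hj⟩ := h
  rwa [p.eq_of_mem_parts hV hW hi hi']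

theorem part_ext {m : ℕ} {p q : Part m} (h : ∀ i j, Linked p.parts i j ↔ Linked q.parts i j) :
    p = q := by
  have key : ∀ p q : Part m, (∀ i j, Linked p.parts i j ↔ Linked q.parts i j) →
      p.parts ⊆ q.parts := by
    intro p q h V hV
    obtain ⟨i, hi⟩ := p.nonempty_of_mem_parts hV
    obtain ⟨W, hW, hi'⟩ := q.exists_mem (mem_univ i)
    have : V = W := by
      ext j
      exact ⟨fun hj => mem_of_linked hW hi' ((h i j).1 ⟨V, hV, hi, hj⟩),
        fun hj => mem_of_linked hV hi ((h i j).2 ⟨W, hW, hi', hj⟩)⟩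
    exact this ▸ hW
  exact Finpartition.ext (subset_antisymm (key p q h) (key q p fun i j => (h i j).symm))

theorem finRotate_val {m : ℕ} (i : Fin m) :
    (finRotate m i).val = if i.val + 1 = m then 0 else i.val + 1 := by
  obtain _ | m := m
  · exact i.elim0
  · rw [coe_finRotate]
    simp [Fin.ext_iff]

theorem eq_of_finRotate_invariant {m : ℕ} {β : Type*} {f : Fin m → β}
    (hf : ∀ x, f (finRotate m x) = f x) (i j : Fin m) : f i = f j := by
  have key : ∀ (d : ℕ) (x y : Fin m), x.val + d = y.val → f x = f y := by
    intro d
    induction d with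
    | zero => intro x y hxy; exact congrArg _ (Fin.ext hxy)
    | succ d ih =>
      intro x y hxy
      have h1 := y.isLt
      have h2 := finRotate_val x
      rw [if_neg (by omega)] at h2
      rw [← hf x]
      exact ih _ _ (by omega)
  rcases le_total i.val j.val with hle | hle
  · exact key (j.val - i.val) i j (by omega)
  · exact (key (i.val - j.val) j i (by omega)).symm

/-! ### Planar pairs of permutations. -/

/-- Up to an additive constant, minus the indicator function of the cyclic open interval from `e`
to `s e`. -/
def gap {m : ℕ} (s : Perm (Fin m)) (e y : Fin m) : ℤ :=
  (if 0 < (s e).val ∧ (s e).val ≤ y.val then 1 else 0) - (if e.val < y.val then 1 else 0)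

/-- The function jumps only on arriving at `s e` and on leaving `e`. The rotation being a single
cycle, these jumps determine `gap s e` up to a constant, which is what `planar_of_card` exploits. -/
theorem gap_finRotate {m : ℕ} (s : Perm (Fin m)) (e y : Fin m) :
    gap s e (finRotate m y) =
      gap s e y + (if finRotate m y = s e then 1 else 0) - (if y = e then 1 else 0) := by
  have := finRotate_val y
  have := y.isLt
  have := e.isLt
  have := (s e).isLt
  simp only [gap, Fin.ext_iff]
  split_ifs at * <;> omega

/-- `s` and `t` are the cyclic successor permutations of a non-crossing partition `p` and of its
Kreweras complement `q`. -/
structure Planar {m : ℕ} (p q : Part m) (s t : Perm (Fin m)) : Prop where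
  mul : s * t = finRotate m
  left : ∀ i j, Linked p.parts i j ↔ s.SameCycle i j
  right : ∀ i j, Linked q.parts i j ↔ t.SameCycle i j
  gap_apply : ∀ e a, gap s e (s a) = gap s e a

namespace Planar

variable {m : ℕ} {p q : Part m} {s t : Perm (Fin m)}

theorem gap_eq (h : Planar p q s t) (e : Fin m) {a b : Fin m} (hab : Linked p.parts a b) :
    gap s e a = gap s e b :=
  apply_eq_of_sameCycle (h.gap_apply e) ((h.left a b).1 hab)

theorem apply_apply (h : Planar p q s t) (i : Fin m) : s (t i) = finRotate m i := by
  rw [← h.mul, Perm.mul_apply]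

/-- Since `s (t a)` is the rotation of `a`, invariance of `gap s e` under `s` turns the jump formula
into invariance of `gap s e - δ_e` under `t`. Hence `δ_e` is an `s`-invariant function minus a
`t`-invariant one. -/
theorem gap_sub_apply (h : Planar p q s t) (e a : Fin m) :
    gap s e (t a) - (if t a = e then 1 else 0) = gap s e a - (if a = e then 1 else 0) := by
  have h1 := gap_finRotate s e a
  rw [← h.apply_apply, h.gap_apply] at h1
  simp only [s.injective.eq_iff] at h1
  linarith

theorem gap_sub_eq (h : Planar p q s t) (e : Fin m) {a b : Fin m} (hab : Linked q.parts a b) :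
    gap s e a - (if a = e then 1 else 0) = gap s e b - (if b = e then 1 else 0) :=
  apply_eq_of_sameCycle (f := fun a => gap s e a - (if a = e then 1 else 0))
    (h.gap_sub_apply e) ((h.right a b).1 hab)

/-- A block member strictly inside the cyclic interval from `i` to `s i` would have a different gap
value from `i`. So `p` determines `s`. -/
theorem isNext_left (h : Planar p q s t) (i : Fin m) : IsNext (Linked p.parts) i (s i) := by
  refine ⟨(h.left _ _).2 (Perm.sameCycle_apply_right.2 .rfl), ?_⟩
  rcases lt_or_ge i (s i) with hlt | hge
  · refine Or.inl ⟨hlt, fun j hj hij => ?_⟩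
    have h1 := h.gap_eq i hj
    simp only [gap, Fin.lt_def, Fin.le_def] at *
    split_ifs at h1 <;> omega
  · refine Or.inr fun j hj => ?_
    have h1 := h.gap_eq i hj
    simp only [gap, Fin.le_def] at *
    split_ifs at h1 <;> omega

theorem isNext_right (h : Planar p q s t) (i : Fin m) : IsNext (Linked q.parts) i (t i) := by
  refine ⟨(h.right _ _).2 (Perm.sameCycle_apply_right.2 .rfl), ?_⟩
  have h2 := finRotate_val i
  rw [← h.apply_apply] at h2
  have := i.isLt
  rcases lt_or_ge i (t i) with hlt | hge
  · refine Or.inl ⟨hlt, fun j hj hij => ?_⟩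
    have h1 := h.gap_sub_eq (t i) hj
    have := j.isLt
    simp only [gap, Fin.lt_def, Fin.le_def, Fin.ext_iff] at *
    split_ifs at h1 h2 <;> omega
  · refine Or.inr fun j hj => ?_
    have h1 := h.gap_sub_eq (t i) hj
    have := j.isLt
    simp only [gap, Fin.le_def, Fin.ext_iff] at *
    split_ifs at h1 h2 <;> omega

theorem perm_eq {q' : Part m} {s' t' : Perm (Fin m)} (h : Planar p q s t)
    (h' : Planar p q' s' t') : s = s' ∧ t = t' := by
  have hs : s = s' := Equiv.ext fun i =>
    (h.isNext_left i).eq (h'.isNext_left i)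
  refine ⟨hs, ?_⟩
  have h1 := h.mul.trans h'.mul.symm
  rw [hs] at h1
  exact mul_left_cancel h1

theorem part_eq {q' : Part m} {s' t' : Perm (Fin m)} (h : Planar p q s t)
    (h' : Planar p q' s' t') : q = q' := by
  obtain ⟨-, rfl⟩ := h.perm_eq h'
  exact part_ext fun i j => (h.right i j).trans (h'.right i j).symm

theorem nonCrossing (h : Planar p q s t) : NonCrossing p.parts := by
  have hR := linked_equivalence p
  intro a b c d hab hbc hcd hac hbd
  by_contra hnot
  classical
  have hne : (univ.filter fun j => Linked p.parts a j ∧ j < b).Nonempty :=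
    ⟨a, by simp [hab, hR.refl a]⟩
  -- For `i` the last point of the block of `a` before `b`, the gap from `i` to `s i` contains `b`
  -- but not `d`, although these are linked.
  obtain ⟨i, hi, hmax⟩ := exists_max_image _ id hne
  simp only [mem_filter, mem_univ, true_and, id] at hi hmax
  have hnext := h.isNext_left i
  have hic : Linked p.parts i c := hR.trans (hR.symm hi.1) hac
  have h1 := h.gap_eq i hbd
  have hsb : s i ≠ b := fun hh => hnot (hh ▸ hR.trans hi.1 hnext.1)
  obtain ⟨hn, hn' | hn'⟩ := hnext
  · have h2 := hn'.2 c hic (hi.2.trans hbc)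
    have h3 : ¬ s i < b := fun hh => absurd hn'.1 (not_lt.2 (hmax _ ⟨hR.trans hi.1 hn, hh⟩))
    have h4 := hn'.1
    simp only [gap, Fin.lt_def, Fin.le_def, Fin.ext_iff, ne_eq] at *
    split_ifs at h1 <;> omega
  · exact absurd (hn' c hic).2 (not_le.2 (hi.2.trans hbc))

/-- If no block of `p` separates `i` and `j`, then every `gap s e - δ_e` agrees at `i` and `j`.
Summing over `e` in the `t`-orbit of `i` writes the indicator of that orbit as `Φ - Ψ`. Here `Φ` is
invariant under `s` and `t`, hence constant, and `Ψ i = Ψ j`, so `j` is in the orbit. For the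
converse, the gap of `t x` shows that no block separates `x` from `t x`. -/
theorem krSetoid_iff (h : Planar p q s t) (i j : Fin m) :
    krSetoid p i j ↔ Linked q.parts i j := by
  constructor
  · intro hij
    have hpsi : ∀ e, gap s e i - (if i = e then 1 else 0) =
        gap s e j - (if j = e then 1 else 0) := by
      intro e
      have h1 := hij e (s e) (h.isNext_left e).1
      simp only [gap, Fin.le_def, Fin.ext_iff] at *
      split_ifs <;> omega
    rw [h.right]
    classical
    set f : Fin m → ℤ := fun x => if t.SameCycle i x then 1 else 0 with hf
    have hft : ∀ x, f (t x) = f x := fun x => by simp [hf, Perm.sameCycle_apply_right]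
    set Φ : Fin m → ℤ := fun x => ∑ e, f e * gap s e x with hΦ
    set Ψ : Fin m → ℤ := fun x => ∑ e, f e * (gap s e x - if x = e then 1 else 0) with hΨ
    have hsub : ∀ x, Φ x - Ψ x = f x := fun x => by
      simp [hΦ, hΨ, mul_sub, sum_sub_distrib]
    have hΦs : ∀ x, Φ (s x) = Φ x := fun x => by simp [hΦ, h.gap_apply]
    have hΨt : ∀ x, Ψ (t x) = Ψ x := fun x => by simp [hΨ, h.gap_sub_apply]
    have hc : ∀ x, Φ (finRotate m x) = Φ x := fun x => by
      rw [← h.apply_apply, hΦs]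
      have h1 := hsub (t x)
      have h2 := hsub x
      rw [hΨt, hft] at h1
      linarith
    have hΦij : Φ i = Φ j := eq_of_finRotate_invariant hc i j
    have hΨij : Ψ i = Ψ j := by simp [hΨ, hpsi]
    have hfij : f j = f i := by rw [← hsub, ← hsub, hΦij, hΨij]
    by_contra hnot
    simp [hf, hnot, Perm.SameCycle.refl] at hfij
  · intro hij
    refine sameCycle_imp (R := krSetoid p) (krSetoid p).iseqv (fun x a b hab => ?_)
      ((h.right i j).1 hij)
    have h1 := h.gap_eq (t x) hab
    have h2 := finRotate_val x
    rw [← h.apply_apply] at h2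
    have := x.isLt
    have := a.isLt
    have := b.isLt
    simp only [gap, Fin.le_def] at *
    split_ifs at h1 h2 <;> omega

end Planar

/-! ### Kreweras complements yield planar pairs. -/

section

variable {m : ℕ}

open Classical in
theorem nonCrossing_blocksUnion_krSetoid (p : NC m) :
    NonCrossing (blocksUnion p.1 (Finpartition.ofSetoid (krSetoid p.1))) := by
  intro a b c d hab hbc hcd hac hbd
  rcases plain_or_bar a with ⟨a, rfl⟩ | ⟨a, rfl⟩ <;>
  rcases plain_or_bar b with ⟨b, rfl⟩ | ⟨b, rfl⟩ <;>
  rcases plain_or_bar c with ⟨c, rfl⟩ | ⟨c, rfl⟩ <;>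
  rcases plain_or_bar d with ⟨d, rfl⟩ | ⟨d, rfl⟩ <;>
  simp only [linked_plain_plain, linked_bar_bar, not_linked_plain_bar, not_linked_bar_plain,
    plain_lt_plain, bar_lt_bar, plain_lt_bar, bar_lt_plain, linked_ofSetoid]
    at hab hbc hcd hac hbd ⊢
  · exact p.2 a b c d hab hbc hcd hac hbd
  · have := hbd a c hac
    grind
  · have := hac b d hbd
    grind
  · intro x y hxy
    have h1 := hac x y hxy
    have h2 := hbd x y hxy
    grind

theorem krSetoid_of_linked {p q : Part m} (hq : NonCrossing (blocksUnion p q)) {i j : Fin m}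
    (hij : Linked q.parts i j) : krSetoid p i j := by
  have key : ∀ i j x y, i < j → Linked q.parts i j → Linked p.parts x y →
      i < x → x ≤ j → i < y ∧ y ≤ j := by
    intro i j x y hij hl hxy h1 h2
    by_contra hcon
    rcases le_or_gt y i with h | h
    · exact not_linked_plain_bar p q y i (hq (plain y) (bar i) (plain x) (bar j)
        ((plain_lt_bar _ _).2 h) ((bar_lt_plain _ _).2 h1) ((plain_lt_bar _ _).2 h2)
        ((linked_plain_plain _ _ _ _).2 (linked_symm hxy)) ((linked_bar_bar _ _ _ _).2 hl))
    · have h' : j < y := lt_of_not_ge fun h'' => hcon ⟨h, h''⟩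
      exact not_linked_bar_plain p q i x (hq (bar i) (plain x) (bar j) (plain y)
        ((bar_lt_plain _ _).2 h1) ((plain_lt_bar _ _).2 h2) ((bar_lt_plain _ _).2 h')
        ((linked_bar_bar _ _ _ _).2 hl) ((linked_plain_plain _ _ _ _).2 hxy))
  intro x y hxy
  rcases lt_trichotomy i j with h | h | h
  · have h1 := key i j x y h hij hxy
    have h2 := key i j y x h hij (linked_symm hxy)
    grind
  · subst h
    tauto
  · have h1 := key j i x y h (linked_symm hij) hxy
    have h2 := key j i y x h (linked_symm hij) (linked_symm hxy)
    grind

/-- The complement is known only as a greatest element. Compatibility with `p` puts its links inside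
`krSetoid`, and maximality gives the reverse inclusion. -/
theorem linked_kreweras (p : NC m) (i j : Fin m) :
    Linked (kreweras p).parts i j ↔ krSetoid p.1 i j := by
  classical
  refine ⟨krSetoid_of_linked (kreweras_isGreatest p).1, fun h => ?_⟩
  have hle := (kreweras_isGreatest p).2 (nonCrossing_blocksUnion_krSetoid p)
  obtain ⟨V, hV, hi, hj⟩ := (linked_ofSetoid (krSetoid p.1) i j).2 h
  obtain ⟨W, hW, hVW⟩ := hle hV
  exact ⟨W, hW, hVW hi, hVW hj⟩

/-- The partition of `[m]` into the orbits of a permutation. -/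
theorem exists_orbit_partition (t : Perm (Fin m)) :
    ∃ q : Part m, ∀ i j, Linked q.parts i j ↔ t.SameCycle i j := by
  classical
  exact ⟨Finpartition.ofSetoid (Perm.SameCycle.setoid t), linked_ofSetoid _⟩

/-- A block with points both inside and outside the open cyclic interval between the consecutive
points `e` and `s e` would cross the block of `e`. -/
theorem gap_eq_of_nonCrossing {p : Part m} (hp : NonCrossing p.parts) {s : Perm (Fin m)}
    (hs : ∀ i, IsNext (Linked p.parts) i (s i)) (e : Fin m) {a b : Fin m}
    (hab : Linked p.parts a b) : gap s e a = gap s e b := by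
  have hR := linked_equivalence p
  have key : ∀ a b, Linked p.parts a b → gap s e a < gap s e b → False := by
    intro a b hab hlt
    obtain ⟨he, ⟨hes, hn⟩ | hn⟩ := hs e
    · have h1 : e < a ∧ a < s e := by
        simp only [gap, Fin.lt_def, Fin.le_def] at *
        split_ifs at hlt <;> omega
      have h2 : b ≤ e ∨ s e ≤ b := by
        by_contra hc
        simp only [gap, Fin.lt_def, Fin.le_def, not_or, not_le] at *
        split_ifs at hlt <;> omega
      have hea : ¬ Linked p.parts e a := fun hh => absurd (hn a hh h1.1) (not_le.2 h1.2)
      rcases h2 with h2 | h2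
      · rcases h2.eq_or_lt with rfl | h2
        · exact hea (linked_symm hab)
        · exact hea (hR.trans (linked_symm (hp b e a (s e) h2 h1.1 h1.2 (linked_symm hab) he))
            (linked_symm hab))
      · rcases h2.eq_or_lt with rfl | h2
        · exact hea (hR.trans he (linked_symm hab))
        · exact hea (hp e a (s e) b h1.1 h1.2 h2 he hab)
    -- The interval wraps around here, so the test is membership in its complement, from `s e` up to
    -- `e`.
    · have h1 : ¬ (s e ≤ a ∧ a ≤ e) ∧ (s e ≤ b ∧ b ≤ e) ∨
          (s e ≤ a ∧ a ≤ e) ∧ ¬ (s e ≤ b ∧ b ≤ e) := by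
        have hse := (hn e (hR.refl e)).1
        simp only [gap, Fin.le_def] at *
        split_ifs at hlt <;> omega
      have key' : ∀ a b, Linked p.parts a b → (s e ≤ a ∧ a ≤ e) → ¬ (s e ≤ b ∧ b ≤ e) → False := by
        intro a b hab ha hb
        have hea : ¬ Linked p.parts e a := fun hh => hb (hn b (hR.trans hh hab))
        have ha1 : a ≠ e := fun hh => hea (hh ▸ hR.refl _)
        have ha2 : s e ≠ a := fun hh => hea (hh ▸ he)
        have ha1' := lt_of_le_of_ne ha.2 ha1
        have ha2' := lt_of_le_of_ne ha.1 ha2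
        rcases lt_or_ge b (s e) with hb' | hb'
        · exact hea (hR.trans he (hR.trans (linked_symm (hp b (s e) a e hb' ha2' ha1'
            (linked_symm hab) (linked_symm he))) (linked_symm hab)))
        · have hb'' : e < b := lt_of_not_ge fun hh => hb ⟨hb', hh⟩
          exact hea (hR.trans he (hp (s e) a e b ha2' ha1' hb'' (linked_symm he) hab))
      rcases h1 with h1 | h1
      · exact key' b a (linked_symm hab) h1.2 h1.1
      · exact key' a b hab h1.1 h1.2
  exact le_antisymm (not_lt.1 (key b a (linked_symm hab))) (not_lt.1 (key a b hab))

/-- With `t` forced to be `s⁻¹` times the rotation, `Planar.krSetoid_iff` identifies its orbits with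
the blocks of the complement. -/
theorem exists_planar (p : NC m) : ∃ s t, Planar p.1 (kreweras p) s t := by
  obtain ⟨s, hs, hsc⟩ := exists_next_perm (linked_equivalence p.1)
  obtain ⟨q, hq⟩ := exists_orbit_partition (s⁻¹ * finRotate m)
  have h : Planar p.1 q s (s⁻¹ * finRotate m) :=
    { mul := by simp
      left := hsc
      right := hq
      gap_apply := fun e a => gap_eq_of_nonCrossing p.2 hs e (linked_symm (hs a).1) }
  have : q = kreweras p := part_ext fun i j => by rw [← h.krSetoid_iff, linked_kreweras]
  exact ⟨s, _, this ▸ h⟩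

theorem Planar.kreweras_eq {p : NC m} {q : Part m} {s t : Perm (Fin m)} (h : Planar p.1 q s t) :
    q = kreweras p := by
  obtain ⟨s', t', h'⟩ := exists_planar p
  exact h.part_eq h'

/-! ### Counting blocks by dimensions of spaces of invariant functions. -/

/-- The functions that are constant on the blocks of a partition. -/
def invariants (p : Part m) : Submodule ℚ (Fin m → ℚ) where
  carrier := {f | ∀ i j, Linked p.parts i j → f i = f j}
  add_mem' := fun hf hg i j h => by simp [hf i j h, hg i j h]
  zero_mem' := fun _ _ _ => rfl
  smul_mem' := fun c f hf i j h => by simp [hf i j h]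

theorem finrank_invariants (p : Part m) : Module.finrank ℚ (invariants p) = p.parts.card := by
  set b : Fin m → p.parts := fun i => ⟨p.part i, p.part_mem.2 (mem_univ i)⟩ with hb
  have hmem : ∀ i, i ∈ p.part i := fun i => p.mem_part (mem_univ i)
  have hbl : ∀ i j, Linked p.parts i j → b i = b j := fun i j ⟨V, hV, hi, hj⟩ => by
    simp only [hb, Subtype.mk.injEq]
    rw [p.part_eq_of_mem hV hi, p.part_eq_of_mem hV hj]
  have hsurj : Function.Surjective b := fun ⟨V, hV⟩ => by
    obtain ⟨i, hi⟩ := p.nonempty_of_mem_parts hV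
    exact ⟨i, Subtype.ext (p.part_eq_of_mem hV hi)⟩
  have hrange : invariants p = LinearMap.range (LinearMap.funLeft ℚ ℚ b) := by
    ext f
    constructor
    · intro hf
      refine ⟨fun V => f (Function.surjInv hsurj V), funext fun i => ?_⟩
      have h1 := Function.surjInv_eq hsurj (b i)
      refine hf _ _ ⟨p.part i, p.part_mem.2 (mem_univ i), ?_, hmem i⟩
      have h2 := congrArg Subtype.val h1
      simp only [hb] at h2
      rw [← h2]
      exact hmem _
    · rintro ⟨g, rfl⟩ i j hij
      simp [LinearMap.funLeft_apply, hbl i j hij]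
  rw [hrange, LinearMap.finrank_range_of_inj (LinearMap.funLeft_injective_of_surjective ℚ ℚ b hsurj)]
  simp

/-- This is the dimension formula for a sum of subspaces, whose intersection is here the line of
constants. -/
theorem card_add_card_of_connected (hm : 0 < m) {p q : Part m}
    (hconn : ∀ f : Fin m → ℚ, f ∈ invariants p → f ∈ invariants q → ∀ i j, f i = f j) :
    p.parts.card + q.parts.card =
      Module.finrank ℚ ↥(invariants p ⊔ invariants q) + 1 := by
  have h1 := Submodule.finrank_sup_add_finrank_inf_eq (invariants p) (invariants q)
  have h2 : invariants p ⊓ invariants q = Submodule.span ℚ {(fun _ => 1 : Fin m → ℚ)} := by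
    ext f
    rw [Submodule.mem_inf, Submodule.mem_span_singleton]
    constructor
    · rintro ⟨hp, hq⟩
      exact ⟨f ⟨0, hm⟩, funext fun i => by simpa using hconn f hp hq _ _⟩
    · rintro ⟨c, rfl⟩
      exact ⟨fun _ _ _ => rfl, fun _ _ _ => rfl⟩
  have h3 : (fun _ => 1 : Fin m → ℚ) ≠ 0 := fun h => one_ne_zero (congrFun h ⟨0, hm⟩)
  rw [h2, finrank_span_singleton h3, finrank_invariants, finrank_invariants] at h1
  exact h1.symm

theorem invariants_sup_eq_top {p q : Part m}
    (hconn : ∀ f : Fin m → ℚ, f ∈ invariants p → f ∈ invariants q → ∀ i j, f i = f j)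
    (hcard : m + 1 ≤ p.parts.card + q.parts.card) : invariants p ⊔ invariants q = ⊤ := by
  obtain rfl | hm := Nat.eq_zero_or_pos m
  · exact Subsingleton.elim _ _
  · apply Submodule.eq_top_of_finrank_eq
    have h1 := card_add_card_of_connected hm hconn
    have h2 := Submodule.finrank_le (invariants p ⊔ invariants q)
    simp only [Module.finrank_fintype_fun_eq_card, Fintype.card_fin] at h2 ⊢
    omega

theorem connected_of_mul_eq_finRotate {p q : Part m} {s t : Perm (Fin m)}
    (mul : s * t = finRotate m) (left : ∀ i j, Linked p.parts i j ↔ s.SameCycle i j)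
    (right : ∀ i j, Linked q.parts i j ↔ t.SameCycle i j) (f : Fin m → ℚ)
    (hp : f ∈ invariants p) (hq : f ∈ invariants q) (i j : Fin m) : f i = f j := by
  refine eq_of_finRotate_invariant (fun x => ?_) i j
  rw [← mul, Perm.mul_apply]
  exact (hp _ _ ((left _ _).2 (Perm.sameCycle_apply_left.2 .rfl))).trans
    (hq _ _ ((right _ _).2 (Perm.sameCycle_apply_left.2 .rfl)))

/-- The functions `gap s e` split every `δ_e` between the two invariant spaces, so these spaces span
everything. -/
theorem Planar.card_add_card (hm : 0 < m) {p q : Part m} {s t : Perm (Fin m)}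
    (h : Planar p q s t) : p.parts.card + q.parts.card = m + 1 := by
  rw [card_add_card_of_connected hm (connected_of_mul_eq_finRotate h.mul h.left h.right)]
  suffices invariants p ⊔ invariants q = ⊤ by
    rw [this, finrank_top, Module.finrank_fintype_fun_eq_card, Fintype.card_fin]
  rw [eq_top_iff]
  intro f _
  have hf : f = (fun x => ∑ e, f e * (gap s e x : ℚ)) -
      fun x => ∑ e, f e * ((gap s e x - if x = e then 1 else 0 : ℤ) : ℚ) := by
    ext x
    simp [mul_sub, sum_sub_distrib]
  rw [hf, sub_eq_add_neg]
  refine Submodule.add_mem_sup (fun i j hij => ?_) (Submodule.neg_mem _ fun i j hij => ?_)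
  · simp [h.gap_eq _ hij]
  · simp only [h.gap_sub_eq _ hij]

/-- With enough blocks, `δ_e = f + g` for some `f` invariant under `s` and `g` invariant under `t`.
Then `f` has the same jumps along the rotation as `gap s e`, so the two differ by a constant and
`gap s e` is `s`-invariant. -/
theorem planar_of_card {p q : Part m} {s t : Perm (Fin m)}
    (mul : s * t = finRotate m) (left : ∀ i j, Linked p.parts i j ↔ s.SameCycle i j)
    (right : ∀ i j, Linked q.parts i j ↔ t.SameCycle i j)
    (hcard : m + 1 ≤ p.parts.card + q.parts.card) : Planar p q s t := by
  refine ⟨mul, left, right, fun e a => ?_⟩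
  have htop := invariants_sup_eq_top (connected_of_mul_eq_finRotate mul left right) hcard
  have hst : ∀ i, s (t i) = finRotate m i := fun i => by rw [← mul, Perm.mul_apply]
  have hmem : (fun x => if x = e then 1 else 0 : Fin m → ℚ) ∈ invariants p ⊔ invariants q :=
    htop ▸ Submodule.mem_top
  obtain ⟨f, hf, g, hg, hfg⟩ := Submodule.mem_sup.1 hmem
  have hfs : ∀ x, f (s x) = f x := fun x =>
    hf _ _ ((left _ _).2 (Perm.sameCycle_apply_left.2 .rfl))
  have hgt : ∀ x, g (t x) = g x := fun x =>
    hg _ _ ((right _ _).2 (Perm.sameCycle_apply_left.2 .rfl))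
  have hfx : ∀ x, f x + g x = if x = e then 1 else 0 := fun x => congrFun hfg x
  have hfc : ∀ x, f (finRotate m x) - gap s e (finRotate m x) = f x - gap s e x := by
    intro x
    have h1 := hfx x
    have h2 := hfx (t x)
    rw [gap_finRotate]
    push_cast
    rw [← hst, hfs]
    simp only [s.injective.eq_iff]
    rw [hgt] at h2
    linarith
  have h1 := eq_of_finRotate_invariant (f := fun x => f x - gap s e x) hfc (s a) a
  simp only [hfs] at h1
  exact_mod_cast (sub_right_injective h1)

end

/-! ### Reduction mod `n`. -/

section

variable {k n : ℕ}

theorem red_val (x : Fin ((k + 1) * n)) : (red k n x).val = x.val % n := rfl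

theorem red_finRotate (x : Fin ((k + 1) * n)) :
    red k n (finRotate _ x) = finRotate n (red k n x) := by
  have hx := x.isLt
  have hn : 0 < n := Nat.pos_of_ne_zero fun h => by subst h; simp at hx
  ext
  have h0 := Nat.mod_lt x.val hn
  rw [red_val, finRotate_val, finRotate_val, red_val]
  have h1 : (x.val + 1) % n = if x.val % n + 1 = n then 0 else x.val % n + 1 := by
    rw [Nat.add_mod]
    split_ifs with h
    · rcases (show n = 1 ∨ 1 < n by omega) with h1 | h1
      · simp [h1, Nat.mod_one]
      · rw [Nat.mod_eq_of_lt h1, h, Nat.mod_self]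
    · rw [Nat.mod_eq_of_lt (show 1 < n by omega), Nat.mod_eq_of_lt (by omega)]
  rw [← h1]
  split_ifs with h
  · rw [h, Nat.mul_mod_left, Nat.zero_mod]
  · rfl

theorem red_finProdFinEquiv (a : Fin (k + 1)) (i : Fin n) :
    red k n (finProdFinEquiv (a, i)) = i := by
  ext
  rw [red_val]
  simp [finProdFinEquiv, Nat.mod_eq_of_lt i.isLt]

theorem finProdFinEquiv_symm_snd (x : Fin ((k + 1) * n)) :
    (finProdFinEquiv.symm x).2 = red k n x := rfl

theorem red_surjective : Function.Surjective (red k n) := fun i =>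
  ⟨finProdFinEquiv (0, i), red_finProdFinEquiv 0 i⟩

theorem card_filter_red_eq (i : Fin n) :
    (univ.filter fun x : Fin ((k + 1) * n) => red k n x = i).card = k + 1 := by
  have : (univ.filter fun x : Fin ((k + 1) * n) => red k n x = i) =
      univ.image fun a : Fin (k + 1) => finProdFinEquiv (a, i) := by
    ext x
    simp only [mem_filter, mem_univ, true_and, mem_image]
    constructor
    · rintro rfl
      exact ⟨(finProdFinEquiv.symm x).1, finProdFinEquiv.apply_symm_apply x⟩
    · rintro ⟨a, rfl⟩
      exact red_finProdFinEquiv a i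
  rw [this, card_image_of_injective _ fun a b h => by simpa using h, card_univ, Fintype.card_fin]

theorem linked_red {π : Part ((k + 1) * n)} {p : Part n} (h : redBlocks k n π = p.parts)
    {x y : Fin ((k + 1) * n)} (hxy : Linked π.parts x y) :
    Linked p.parts (red k n x) (red k n y) := by
  obtain ⟨V, hV, hx, hy⟩ := hxy
  exact ⟨V.image (red k n), h ▸ mem_image_of_mem _ hV, mem_image_of_mem _ hx,
    mem_image_of_mem _ hy⟩

theorem exists_linked_of_red {π : Part ((k + 1) * n)} {p : Part n}
    (h : redBlocks k n π = p.parts) {i j : Fin n} (hij : Linked p.parts i j) :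
    ∃ x y, red k n x = i ∧ red k n y = j ∧ Linked π.parts x y := by
  obtain ⟨M, hM, hi, hj⟩ := hij
  rw [← h] at hM
  obtain ⟨V, hV, rfl⟩ := mem_image.1 hM
  obtain ⟨x, hx, rfl⟩ := mem_image.1 hi
  obtain ⟨y, hy, rfl⟩ := mem_image.1 hj
  exact ⟨x, y, rfl, rfl, V, hV, hx, hy⟩

/-- The blocks over `M` are disjoint and each contains one of the `k + 1` points over a fixed `i ∈
M`. -/
theorem card_parts_le {π : Part ((k + 1) * n)} {p : Part n} (h : redBlocks k n π = p.parts) :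
    π.parts.card ≤ (k + 1) * p.parts.card := by
  rw [← h]
  refine card_le_mul_card_image _ _ fun M hM => ?_
  rw [← redBlocks, h] at hM
  obtain ⟨i, hi⟩ := p.nonempty_of_mem_parts hM
  refine le_of_le_of_eq ?_ (card_filter_red_eq (k := k) i)
  have hex : ∀ V ∈ π.parts.filter (fun V => V.image (red k n) = M), ∃ x ∈ V, red k n x = i := by
    intro V hV
    rw [mem_filter] at hV
    rw [← hV.2] at hi
    exact mem_image.1 hi
  obtain ⟨x₀, -⟩ := red_surjective (k := k) i
  have : Nonempty (Fin ((k + 1) * n)) := ⟨x₀⟩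
  choose! f hf using hex
  refine card_le_card_of_injOn f (fun V hV => ?_) fun V hV W hW hVW => ?_
  · simp [(hf V hV).2]
  · exact π.eq_of_mem_parts (mem_filter.1 hV).1 (mem_filter.1 hW).1 (hf V hV).1
      (hVW ▸ (hf W hW).1)

/-- The cyclic successor permutation of a non-crossing partition of type `k` is a lift of that of
its reduction. -/
theorem red_perm_apply {π : Part ((k + 1) * n)} {π' : Part ((k + 1) * n)}
    {σ τ : Perm (Fin ((k + 1) * n))} (hπ : Planar π π' σ τ) {p q q' : Part n} {s t : Perm (Fin n)}
    (hp : Planar p q s t) (h : redBlocks k n π = p.parts) (h' : redBlocks k n π' = q'.parts)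
    (x : Fin ((k + 1) * n)) : red k n (σ x) = s (red k n x) := by
  have hn : 0 < n := Nat.pos_of_ne_zero fun h => by
    subst h
    exact absurd x.isLt (by simp)
  have hN : 0 < (k + 1) * n := Nat.mul_pos (Nat.succ_pos k) hn
  have hστ : ∀ x, σ (τ x) = finRotate _ x := hπ.apply_apply
  have hσl : ∀ x, Linked π.parts x (σ x) := fun x => (hπ.isNext_left x).1
  have hτl : ∀ x, Linked π'.parts x (τ x) := fun x => (hπ.isNext_right x).1
  have hconn : ∀ f : Fin n → ℚ, f ∈ invariants p → f ∈ invariants q' → ∀ i j, f i = f j := by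
    intro f hf hf' i j
    obtain ⟨x, rfl⟩ := red_surjective (k := k) i
    obtain ⟨y, rfl⟩ := red_surjective (k := k) j
    exact connected_of_mul_eq_finRotate hπ.mul hπ.left hπ.right (fun x => f (red k n x))
      (fun x y hxy => hf _ _ (linked_red h hxy)) (fun x y hxy => hf' _ _ (linked_red h' hxy)) x y
  -- Upstairs there are `(k + 1) * n + 1` blocks, at most `k + 1` over each block downstairs.
  have hcard : n + 1 ≤ p.parts.card + q'.parts.card := by
    have h1 := hπ.card_add_card hN
    have h2 := card_parts_le h
    have h3 := card_parts_le h'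
    by_contra hc
    have h4 := Nat.mul_le_mul_left (k + 1) (show p.parts.card + q'.parts.card ≤ n by omega)
    rw [Nat.mul_add] at h4
    omega
  have htop := invariants_sup_eq_top hconn hcard
  -- Since `δ_i` splits between the two spaces, a block of `p` and a block of `q'` share at most one
  -- point.
  have huniq : ∀ i j, Linked p.parts i j → Linked q'.parts i j → i = j := by
    intro i j hij hij'
    have hmem : (fun x => if x = i then 1 else 0 : Fin n → ℚ) ∈ invariants p ⊔ invariants q' :=
      htop ▸ Submodule.mem_top
    obtain ⟨f, hf, g, hg, hfg⟩ := Submodule.mem_sup.1 hmem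
    have h1 := congrFun hfg i
    have h2 := congrFun hfg j
    simp only [Pi.add_apply, if_true] at h1 h2
    rw [hf i j hij, hg i j hij', h2] at h1
    by_contra hne
    simp [Ne.symm hne] at h1
  -- The point `red (τ x)` is in the `q'`-block of `red x` and in the `p`-block of the rotation of
  -- `red x`; these two blocks meet at most once, so `τ` descends.
  have hτred : ∀ x y, red k n x = red k n y → red k n (τ x) = red k n (τ y) := by
    intro x y hxy
    apply huniq
    · have h1 := linked_red h (hσl (τ x))
      have h2 := linked_red h (hσl (τ y))
      rw [hστ, red_finRotate] at h1 h2
      rw [← hxy] at h2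
      exact (linked_equivalence p).trans h1 (linked_symm h2)
    · have h1 := linked_red h' (hτl x)
      have h2 := linked_red h' (hτl y)
      rw [← hxy] at h2
      exact (linked_equivalence q').trans (linked_symm h1) h2
  set f : Fin n → Fin n := fun i => red k n (τ (Function.surjInv (red_surjective (k := k)) i))
    with hf
  have hfred : ∀ x, red k n (τ x) = f (red k n x) := fun x =>
    hτred _ _ (Function.surjInv_eq _ _).symm
  have hfsurj : Function.Surjective f := fun i => by
    obtain ⟨x, rfl⟩ := red_surjective (k := k) i
    exact ⟨red k n (τ.symm x), by rw [← hfred, apply_symm_apply]⟩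
  set t' : Perm (Fin n) := ofBijective f (Finite.surjective_iff_bijective.1 hfsurj) with ht'
  have htred : ∀ x, red k n (τ x) = t' (red k n x) := hfred
  set s' : Perm (Fin n) := finRotate n * t'⁻¹ with hs'
  have hsred : ∀ x, red k n (σ x) = s' (red k n x) := by
    intro x
    have h1 := hστ (τ.symm x)
    have h2 := htred (τ.symm x)
    rw [apply_symm_apply] at h1 h2
    simp [h1, red_finRotate, h2, hs', -finRotate_apply]
  have hplanar : Planar p q' s' t' := by
    refine planar_of_card (by simp [hs']) (fun i j => ⟨fun hij => ?_, fun hij => ?_⟩)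
      (fun i j => ⟨fun hij => ?_, fun hij => ?_⟩) hcard
    · obtain ⟨x, y, rfl, rfl, hxy⟩ := exists_linked_of_red h hij
      exact sameCycle_map hsred ((hπ.left x y).1 hxy)
    · refine sameCycle_imp (linked_equivalence p) (fun i => ?_) hij
      obtain ⟨x, rfl⟩ := red_surjective (k := k) i
      exact hsred x ▸ linked_red h (hσl x)
    · obtain ⟨x, y, rfl, rfl, hxy⟩ := exists_linked_of_red h' hij
      exact sameCycle_map htred ((hπ.right x y).1 hxy)
    · refine sameCycle_imp (linked_equivalence q') (fun i => ?_) hij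
      obtain ⟨x, rfl⟩ := red_surjective (k := k) i
      exact htred x ▸ linked_red h' (hτl x)
  rw [hsred, (hplanar.perm_eq hp).1]

end

/-! ### Families of orbits and the order of blocks. -/

section OrbitFamily

variable {E Y : Type*}

/-- `F` is the family of orbits of the permutation `u`. -/
structure OrbitFamily (F : Finset (Finset E)) (u : Perm E) : Prop where
  nonempty : ∀ V ∈ F, V.Nonempty
  exists_mem : ∀ d, ∃ V ∈ F, d ∈ V
  mem_iff : ∀ V ∈ F, ∀ d ∈ V, ∀ e, e ∈ V ↔ u.SameCycle d e

namespace OrbitFamily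

variable {F : Finset (Finset E)} {u : Perm E}

theorem eq_of_mem (h : OrbitFamily F u) {V W : Finset E} (hV : V ∈ F) (hW : W ∈ F) {d : E}
    (hdV : d ∈ V) (hdW : d ∈ W) : V = W := by
  ext e
  rw [h.mem_iff V hV d hdV, h.mem_iff W hW d hdW]

theorem image_eq [DecidableEq E] [Finite E] [Finite Y] {G : Finset (Finset Y)} {v : Perm Y}
    (hG : OrbitFamily G v) (hF : OrbitFamily F u) {r : Y → E} (hr : ∀ x, r (v x) = u (r x))
    {V : Finset Y} (hV : V ∈ G) {M : Finset E} (hM : M ∈ F) {x : Y} (hx : x ∈ V)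
    (hxM : r x ∈ M) : V.image r = M := by
  ext j
  constructor
  · intro hj
    obtain ⟨y, hy, rfl⟩ := mem_image.1 hj
    exact (hF.mem_iff M hM _ hxM _).2 (sameCycle_map hr ((hG.mem_iff V hV x hx y).1 hy))
  · intro hj
    obtain ⟨a, -, rfl⟩ := ((hF.mem_iff M hM _ hxM _).1 hj).exists_pow_eq'
    refine mem_image.2 ⟨(v ^ a) x, (hG.mem_iff V hV x hx _).2 ⟨a, by simp⟩, ?_⟩
    clear hj
    induction a with
    | zero => rfl
    | succ a ih => rw [pow_succ', Perm.mul_apply, hr, ih, pow_succ', Perm.mul_apply]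

theorem image_image_eq [DecidableEq E] [Finite E] [Finite Y] {G : Finset (Finset Y)} {v : Perm Y}
    (hG : OrbitFamily G v) (hF : OrbitFamily F u) {r : Y → E} (hr : ∀ x, r (v x) = u (r x))
    (hsurj : Function.Surjective r) : G.image (Finset.image r) = F := by
  ext M
  constructor
  · intro hM
    obtain ⟨V, hV, rfl⟩ := mem_image.1 hM
    obtain ⟨x, hx⟩ := hG.nonempty V hV
    obtain ⟨M, hM, hxM⟩ := hF.exists_mem (r x)
    rwa [hG.image_eq hF hr hV hM hx hxM]
  · intro hM
    obtain ⟨i, hi⟩ := hF.nonempty M hM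
    obtain ⟨x, rfl⟩ := hsurj i
    obtain ⟨V, hV, hxV⟩ := hG.exists_mem x
    exact mem_image.2 ⟨V, hV, hG.image_eq hF hr hV hM hxV hi⟩

section Order

variable [LinearOrder E]

/-- The inequality `u d ≤ d` serves from here on as the test for `d` being the maximum (top) of its
block. -/
theorem apply_le_iff (h : OrbitFamily F u) (hu : ∀ d, IsNext u.SameCycle d (u d))
    {V : Finset E} (hV : V ∈ F) {d : E} (hd : d ∈ V) : u d ≤ d ↔ ∀ e ∈ V, e ≤ d := by
  constructor
  · intro hle e he
    obtain ⟨-, h1 | h1⟩ := hu d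
    · exact absurd h1.1 (not_lt.2 hle)
    · exact (h1 e ((h.mem_iff V hV d hd e).1 he)).2
  · intro hle
    exact hle _ ((h.mem_iff V hV d hd _).2 (Perm.sameCycle_apply_right.2 .rfl))

theorem exists_top (h : OrbitFamily F u) (hu : ∀ d, IsNext u.SameCycle d (u d))
    {V : Finset E} (hV : V ∈ F) : ∃ d ∈ V, u d ≤ d := by
  obtain ⟨d, hd, hmax⟩ := exists_max_image V id (h.nonempty V hV)
  exact ⟨d, hd, (h.apply_le_iff hu hV hd).2 hmax⟩

/-- Blocks are ordered by their maxima. If `e < d` but `W` is neither nested in `V` nor to its left,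
then some `w' < v < w < d` is a crossing. -/
theorem blockLT_iff (h : OrbitFamily F u) (hF : NonCrossing F)
    (hu : ∀ d, IsNext u.SameCycle d (u d)) {V W : Finset E} (hV : V ∈ F) (hW : W ∈ F) {d e : E}
    (hd : d ∈ V) (hdt : u d ≤ d) (he : e ∈ W) (het : u e ≤ e) : BlockLT W V ↔ e < d := by
  rw [h.apply_le_iff hu hV hd] at hdt
  rw [h.apply_le_iff hu hW he] at het
  constructor
  · rintro (⟨-, w, hw, hlt⟩ | hlt)
    · exact (hlt e he).trans_le (hdt w hw)
    · exact hlt e he d hd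
  · intro hlt
    by_cases hc : ∃ v ∈ V, ∀ w ∈ W, v < w
    · exact Or.inl ⟨hc, d, hd, fun w hw => (het w hw).trans_lt hlt⟩
    · push Not at hc
      refine Or.inr fun w hw v hv => ?_
      by_contra hvw
      have hne : ∀ x, x ∈ V → x ∈ W → False := fun x hx hx' => by
        have := h.eq_of_mem hV hW hx hx'
        subst this
        exact absurd (het d hd) (not_le.2 hlt)
      have hvw' : v < w := lt_of_le_of_ne (not_lt.1 hvw) fun hh => hne v hv (hh ▸ hw)
      obtain ⟨w', hw', hle⟩ := hc v hv
      have hlt' : w' < v := lt_of_le_of_ne hle fun hh => hne v hv (hh ▸ hw')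
      obtain ⟨U, hU, h1, h2⟩ := hF w' v w d hlt' hvw' ((het w hw).trans_lt hlt)
        ⟨W, hW, hw', hw⟩ ⟨V, hV, hv, hd⟩
      have h3 := h.eq_of_mem hU hW h1 hw'
      exact hne v hv (h3 ▸ h2)

end Order

end OrbitFamily

end OrbitFamily

/-! ### Numbering blocks by counting tops. -/

section Rank

theorem eq_of_sameCycle_of_apply_le {E : Type*} [LinearOrder E] {u : Perm E}
    (hu : ∀ d, IsNext u.SameCycle d (u d)) {d e : E}
    (hd : u d ≤ d) (he : u e ≤ e) (hde : u.SameCycle d e) : d = e := by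
  obtain ⟨-, h1 | h1⟩ := hu d
  · exact absurd h1.1 (not_lt.2 hd)
  · obtain ⟨-, h2 | h2⟩ := hu e
    · exact absurd h2.1 (not_lt.2 he)
    · exact le_antisymm (h2 d hde.symm).2 (h1 e hde).2

variable {E : Type*} [LinearOrder E] [Fintype E]

/-- The number of last elements of cycles below `d`. -/
def lo (u : Perm E) (d : E) : ℕ := (univ.filter fun e => u e ≤ e ∧ e < d).card

/-- The number of last elements of cycles below or at `d`. -/
def hi (u : Perm E) (d : E) : ℕ := (univ.filter fun e => u e ≤ e ∧ e ≤ d).card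

variable {u : Perm E}

theorem hi_eq_lo_add_one {d : E} (h : u d ≤ d) : hi u d = lo u d + 1 := by
  have : (univ.filter fun e => u e ≤ e ∧ e ≤ d) =
      insert d (univ.filter fun e => u e ≤ e ∧ e < d) := by
    ext e
    simp only [mem_filter, mem_univ, true_and, mem_insert, le_iff_lt_or_eq (b := d)]
    grind
  rw [hi, this, card_insert_of_notMem (by simp), lo]

theorem hi_eq_lo {d : E} (h : d < u d) : hi u d = lo u d := by
  unfold hi lo
  congr 1
  ext e
  simp only [mem_filter, mem_univ, true_and]
  grind

theorem lo_mono {d e : E} (h : d ≤ e) : lo u d ≤ lo u e :=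
  card_le_card fun x hx => by
    simp only [mem_filter, mem_univ, true_and] at hx ⊢
    exact ⟨hx.1, hx.2.trans_le h⟩

theorem lo_lt_of_lt {d e : E} (hd : u d ≤ d) (h : d < e) : lo u d < lo u e := by
  refine card_lt_card ⟨fun x hx => ?_, fun hh => ?_⟩
  · simp only [mem_filter, mem_univ, true_and] at hx ⊢
    exact ⟨hx.1, hx.2.trans h⟩
  · have := hh (show d ∈ _ by simp [hd, h])
    simp at this

theorem lo_injOn {d e : E} (hd : u d ≤ d) (he : u e ≤ e) (h : lo u d = lo u e) : d = e := by
  rcases lt_trichotomy d e with hlt | rfl | hlt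
  · exact absurd h (lo_lt_of_lt hd hlt).ne
  · rfl
  · exact absurd h (lo_lt_of_lt he hlt).ne'

theorem lo_lt_card {d : E} (hd : u d ≤ d) : lo u d < (univ.filter fun e => u e ≤ e).card := by
  refine card_lt_card ⟨fun x hx => ?_, fun hh => ?_⟩
  · simp only [mem_filter, mem_univ, true_and] at hx ⊢
    exact hx.1
  · have := hh (show d ∈ _ by simp [hd])
    simp at this

theorem exists_lo_eq {j : ℕ} (hj : j < (univ.filter fun e => u e ≤ e).card) :
    ∃ d, u d ≤ d ∧ lo u d = j := by
  have h : (univ.filter fun e => u e ≤ e).image (lo u) =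
      range (univ.filter fun e => u e ≤ e).card := by
    refine eq_of_subset_of_card_le (fun x hx => ?_) ?_
    · obtain ⟨d, hd, rfl⟩ := mem_image.1 hx
      exact mem_range.2 (lo_lt_card (mem_filter.1 hd).2)
    · rw [card_range, card_image_of_injOn]
      intro d hd e he hde
      exact lo_injOn (mem_filter.1 hd).2 (mem_filter.1 he).2 hde
  have := h ▸ mem_range.2 hj
  obtain ⟨d, hd, rfl⟩ := mem_image.1 this
  exact ⟨d, (mem_filter.1 hd).2, rfl⟩

theorem OrbitFamily.card_filter_eq {F : Finset (Finset E)} (h : OrbitFamily F u)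
    (hu : ∀ d, IsNext u.SameCycle d (u d)) (A : Finset E → Prop) [DecidablePred A]
    (B : E → Prop) [DecidablePred B] (hAB : ∀ V ∈ F, ∀ d ∈ V, u d ≤ d → (A V ↔ B d)) :
    (F.filter A).card = (univ.filter fun e => u e ≤ e ∧ B e).card := by
  have hex : ∀ V : F, ∃ d ∈ V.1, u d ≤ d := fun V => h.exists_top hu V.2
  choose f hf using hex
  refine card_bij (fun V hV => f ⟨V, (mem_filter.1 hV).1⟩) (fun V hV => ?_)
    (fun V hV W hW hVW => ?_) fun d hd => ?_
  · obtain ⟨hV, hA⟩ := mem_filter.1 hV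
    have h1 := hf ⟨V, hV⟩
    simp [h1.2, (hAB V hV _ h1.1 h1.2).1 hA]
  · have hV' := (mem_filter.1 hV).1
    have hW' := (mem_filter.1 hW).1
    exact h.eq_of_mem hV' hW' (hf ⟨V, hV'⟩).1 (by rw [hVW]; exact (hf ⟨W, hW'⟩).1)
  · simp only [mem_filter, mem_univ, true_and] at hd
    obtain ⟨V, hV, hdV⟩ := h.exists_mem d
    have h1 := hf ⟨V, hV⟩
    refine ⟨V, mem_filter.2 ⟨hV, (hAB V hV d hdV hd.1).2 hd.2⟩, le_antisymm ?_ ?_⟩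
    · exact (h.apply_le_iff hu hV hdV).1 hd.1 _ h1.1
    · exact (h.apply_le_iff hu hV h1.1).1 h1.2 _ hdV

theorem OrbitFamily.card_eq {F : Finset (Finset E)} (h : OrbitFamily F u)
    (hu : ∀ d, IsNext u.SameCycle d (u d)) : F.card = (univ.filter fun e => u e ≤ e).card := by
  have := h.card_filter_eq hu (fun _ => True) (fun _ => True) (by simp)
  simpa using this

theorem OrbitFamily.isNthBlock_iff {F : Finset (Finset E)} (h : OrbitFamily F u)
    (hF : NonCrossing F) (hu : ∀ d, IsNext u.SameCycle d (u d)) {V : Finset E} (hV : V ∈ F) {d : E}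
    (hd : d ∈ V) (hdt : u d ≤ d) (i : ℕ) : IsNthBlock F i V ↔ lo u d = i := by
  classical
  have h1 := h.card_filter_eq hu (fun W => BlockLT W V) (fun e => e < d)
    fun W hW e he het => h.blockLT_iff hF hu hV hW hd hdt he het
  rw [IsNthBlock, lo, ← h1]
  simp only [hV, true_and]

end Rank

/-! ### Lifts of a permutation and their monodromy. -/

section Cover

variable {ι E X : Type*}

/-- The permutation of `X × ι` that lifts `u` and acts through `g` on the fibres. -/
def shear (g : ι → Perm X) (u : Perm ι) : Perm (X × ι) where
  toFun z := (g z.2 z.1, u z.2)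
  invFun z := ((g (u.symm z.2)).symm z.1, u.symm z.2)
  left_inv z := by simp
  right_inv z := by simp

@[simp] theorem shear_apply (g : ι → Perm X) (u : Perm ι) (z : X × ι) :
    shear g u z = (g z.2 z.1, u z.2) := rfl

variable [LinearOrder E] [Fintype E]

/-- The transition permutations of the lift of `u` with partial monodromies `P`. -/
def transition (u : Perm E) (P : ℕ → Perm X) (d : E) : Perm X := (P (lo u (u d)))⁻¹ * P (hi u d)

variable {u : Perm E} {P : ℕ → Perm X}

/-- Below the top, `hi = lo`, so the coordinate `P (lo u d) x` stays unchanged while the lift climbs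
along the cycle. -/
theorem sameCycle_shear_top [Finite X] (hu : ∀ d, IsNext u.SameCycle d (u d)) {m : E}
    (hm : u m ≤ m) (d : E) (hd : u.SameCycle d m) (x : X) :
    (shear (transition u P) u).SameCycle (x, d) ((P (lo u m))⁻¹ (P (lo u d) x), m) := by
  induction d using WellFoundedGT.induction generalizing x with
  | ind d ih =>
    rcases lt_or_ge d (u d) with hlt | hge
    · have h1 := ih (u d) hlt (Perm.sameCycle_apply_left.2 hd) (transition u P d x)
      rw [← Perm.sameCycle_apply_left]
      simpa [transition, hi_eq_lo hlt] using h1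
    · have hdm : d = m := eq_of_sameCycle_of_apply_le hu hge hm hd
      subst hdm
      simp [Perm.SameCycle.refl]

/-- In the flat coordinate `P (lo u d) x` the lift acts trivially except at the top `m`, where it
acts by `P (lo u m + 1) * (P (lo u m))⁻¹`. This permutation is therefore the first return map to the
fibre over `m`. -/
theorem sameCycle_shear_iff [Finite X] (hu : ∀ d, IsNext u.SameCycle d (u d)) {m : E}
    (hm : u m ≤ m) (y y' : X) :
    (shear (transition u P) u).SameCycle ((P (lo u m))⁻¹ y, m) ((P (lo u m))⁻¹ y', m) ↔
      (P (lo u m + 1) * (P (lo u m))⁻¹).SameCycle y y' := by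
  set α := P (lo u m + 1) * (P (lo u m))⁻¹ with hα
  constructor
  · intro h
    have h1 := apply_eq_of_sameCycle (β := Set X)
      (f := fun z => {w | u.SameCycle z.2 m ∧ α.SameCycle (P (lo u z.2) z.1) w})
      (fun z => ?_) h
    · have h2 : y' ∈ {w | u.SameCycle m m ∧ α.SameCycle (P (lo u m) ((P (lo u m))⁻¹ y)) w} := by
        simp only at h1
        rw [h1]
        simp [Perm.SameCycle.refl]
      simpa [Perm.SameCycle.refl] using h2
    · obtain ⟨x, d⟩ := z
      ext w
      simp only [shear_apply, Set.mem_ofPred_eq, Perm.sameCycle_apply_left]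
      refine and_congr_right fun hd => ?_
      rcases lt_or_ge d (u d) with hlt | hge
      · simp [transition, hi_eq_lo hlt]
      · have hdm : d = m := eq_of_sameCycle_of_apply_le hu hge hm hd
        subst hdm
        have : P (lo u (u d)) (transition u P d x) = α (P (lo u d) x) := by
          simp [transition, hi_eq_lo_add_one hge, hα]
        rw [this, Perm.sameCycle_apply_left]
  · refine sameCycle_imp (R := fun y y' => (shear (transition u P) u).SameCycle
      ((P (lo u m))⁻¹ y, m) ((P (lo u m))⁻¹ y', m))
      ⟨fun _ => .rfl, fun h => h.symm, fun h h' => h.trans h'⟩ fun y => ?_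
    have h1 := sameCycle_shear_top (P := P) hu hm (u m) (Perm.sameCycle_apply_left.2 .rfl)
      (transition u P m ((P (lo u m))⁻¹ y))
    rw [← Perm.sameCycle_apply_left]
    simpa [transition, hi_eq_lo_add_one hm, hα] using h1

/-- The number of orbits of a permutation. -/
noncomputable def orbitCount (α : Perm X) : ℕ := Nat.card (Quotient (Perm.SameCycle.setoid α))

end Cover

/-! ### The doubled set with its permutation. -/

section Double

variable {m : ℕ}

/-- The permutation of `[m] ∪ [m]‾` acting by `s` on `[m]` and by `t` on `[m]‾`. -/
def double (s t : Perm (Fin m)) : Perm (Doubled m) where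
  toFun d := toLex (if (ofLex d).2 then t (ofLex d).1 else s (ofLex d).1, (ofLex d).2)
  invFun d := toLex (if (ofLex d).2 then t.symm (ofLex d).1 else s.symm (ofLex d).1, (ofLex d).2)
  left_inv d := by
    rcases plain_or_bar d with ⟨i, rfl⟩ | ⟨i, rfl⟩ <;> simp [plain, bar]
  right_inv d := by
    rcases plain_or_bar d with ⟨i, rfl⟩ | ⟨i, rfl⟩ <;> simp [plain, bar]

@[simp] theorem double_plain (s t : Perm (Fin m)) (i : Fin m) :
    double s t (plain i) = plain (s i) := by
  simp [double, plain]

@[simp] theorem double_bar (s t : Perm (Fin m)) (i : Fin m) :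
    double s t (bar i) = bar (t i) := by
  simp [double, bar]

theorem plain_injective : Function.Injective (plain (m := m)) := fun i j h => by
  simpa [plain] using h

theorem bar_injective : Function.Injective (bar (m := m)) := fun i j h => by
  simpa [bar] using h

theorem plain_ne_bar (i j : Fin m) : plain i ≠ bar j := by
  simp [plain, bar]

theorem card_blocksUnion (p q : Part m) :
    (blocksUnion p q).card = p.parts.card + q.parts.card := by
  rw [blocksUnion, card_union_of_disjoint, card_image_of_injective, card_image_of_injective]
  · exact image_injective bar_injective
  · exact image_injective plain_injective
  · rw [disjoint_left]
    intro V hV hV'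
    obtain ⟨W, hW, rfl⟩ := mem_image.1 hV
    obtain ⟨W', hW', h⟩ := mem_image.1 hV'
    obtain ⟨i, hi⟩ := p.nonempty_of_mem_parts hW
    have h1 : plain i ∈ W'.image bar := h ▸ mem_image_of_mem _ hi
    obtain ⟨j, -, hj⟩ := mem_image.1 h1
    exact plain_ne_bar i j hj.symm

theorem linked_blocksUnion_equivalence (p q : Part m) : Equivalence (Linked (blocksUnion p q)) where
  refl d := by
    rcases plain_or_bar d with ⟨i, rfl⟩ | ⟨i, rfl⟩
    · exact (linked_plain_plain p q i i).2 ((linked_equivalence p).refl i)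
    · exact (linked_bar_bar p q i i).2 ((linked_equivalence q).refl i)
  symm := linked_symm
  trans := by
    intro a b c
    rcases plain_or_bar a with ⟨a, rfl⟩ | ⟨a, rfl⟩ <;>
    rcases plain_or_bar b with ⟨b, rfl⟩ | ⟨b, rfl⟩ <;>
    rcases plain_or_bar c with ⟨c, rfl⟩ | ⟨c, rfl⟩ <;>
    simp only [linked_plain_plain, linked_bar_bar, not_linked_plain_bar, not_linked_bar_plain,
      false_implies, implies_true]
    · exact (linked_equivalence p).trans
    · exact (linked_equivalence q).trans

variable {p q : Part m} {s t : Perm (Fin m)}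

theorem linked_blocksUnion_iff (left : ∀ i j, Linked p.parts i j ↔ s.SameCycle i j)
    (right : ∀ i j, Linked q.parts i j ↔ t.SameCycle i j) (d e : Doubled m) :
    Linked (blocksUnion p q) d e ↔ (double s t).SameCycle d e := by
  constructor
  · intro h
    rcases plain_or_bar d with ⟨d, rfl⟩ | ⟨d, rfl⟩ <;>
    rcases plain_or_bar e with ⟨e, rfl⟩ | ⟨e, rfl⟩ <;>
    simp only [linked_plain_plain, linked_bar_bar, not_linked_plain_bar, not_linked_bar_plain]
      at h
    · exact sameCycle_map (fun x => (double_plain s t x).symm) ((left _ _).1 h)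
    · exact sameCycle_map (fun x => (double_bar s t x).symm) ((right _ _).1 h)
  · refine sameCycle_imp (linked_blocksUnion_equivalence p q) fun d => ?_
    rcases plain_or_bar d with ⟨d, rfl⟩ | ⟨d, rfl⟩
    · rw [double_plain, linked_plain_plain, left]
      exact Perm.sameCycle_apply_right.2 .rfl
    · rw [double_bar, linked_bar_bar, right]
      exact Perm.sameCycle_apply_right.2 .rfl

theorem orbitFamily_parts (left : ∀ i j, Linked p.parts i j ↔ s.SameCycle i j) :
    OrbitFamily p.parts s where
  nonempty _ hV := p.nonempty_of_mem_parts hV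
  exists_mem d := p.exists_mem (mem_univ d)
  mem_iff V hV d hd e := by
    rw [← left]
    exact ⟨fun he => ⟨V, hV, hd, he⟩, mem_of_linked hV hd⟩

theorem orbitFamily_blocksUnion (left : ∀ i j, Linked p.parts i j ↔ s.SameCycle i j)
    (right : ∀ i j, Linked q.parts i j ↔ t.SameCycle i j) :
    OrbitFamily (blocksUnion p q) (double s t) where
  nonempty V hV := by
    rw [blocksUnion, mem_union, mem_image, mem_image] at hV
    rcases hV with ⟨W, hW, rfl⟩ | ⟨W, hW, rfl⟩
    · exact (p.nonempty_of_mem_parts hW).image _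
    · exact (q.nonempty_of_mem_parts hW).image _
  exists_mem d := by
    obtain ⟨V, hV, hd, -⟩ := (linked_blocksUnion_equivalence p q).refl d
    exact ⟨V, hV, hd⟩
  mem_iff V hV d hd e := by
    rw [← linked_blocksUnion_iff left right]
    refine ⟨fun he => ⟨V, hV, hd, he⟩, ?_⟩
    rw [blocksUnion, mem_union, mem_image, mem_image] at hV
    rcases hV with ⟨W, hW, rfl⟩ | ⟨W, hW, rfl⟩
    · obtain ⟨i, hi, rfl⟩ := mem_image.1 hd
      rcases plain_or_bar e with ⟨e, rfl⟩ | ⟨e, rfl⟩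
      · rw [linked_plain_plain]
        exact fun h => mem_image_of_mem _ (mem_of_linked hW hi h)
      · exact fun h => absurd h (not_linked_plain_bar _ _ _ _)
    · obtain ⟨i, hi, rfl⟩ := mem_image.1 hd
      rcases plain_or_bar e with ⟨e, rfl⟩ | ⟨e, rfl⟩
      · exact fun h => absurd h (not_linked_bar_plain _ _ _ _)
      · rw [linked_bar_bar]
        exact fun h => mem_image_of_mem _ (mem_of_linked hW hi h)

theorem Planar.isNext_double (h : Planar p q s t) (d : Doubled m) :
    IsNext (double s t).SameCycle d (double s t d) := by
  have hl := linked_blocksUnion_iff h.left h.right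
  have bar_le_bar : ∀ i j : Fin m, bar i ≤ bar j ↔ i ≤ j := fun i j => by
    rw [← not_lt, ← not_lt, bar_lt_bar]
  have plain_le_plain : ∀ i j : Fin m, plain i ≤ plain j ↔ i ≤ j := fun i j => by
    rw [← not_lt, ← not_lt, plain_lt_plain]
  rcases plain_or_bar d with ⟨i, rfl⟩ | ⟨i, rfl⟩
  · rw [double_plain]
    obtain ⟨h1, h2⟩ := h.isNext_left i
    refine ⟨by rwa [← hl, linked_plain_plain], h2.imp (fun h2 => ⟨?_, ?_⟩) ?_⟩
    · rw [plain_lt_plain]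
      exact h2.1
    · intro j hj
      rw [← hl] at hj
      rcases plain_or_bar j with ⟨j, rfl⟩ | ⟨j, rfl⟩
      · rw [linked_plain_plain] at hj
        rw [plain_lt_plain, plain_le_plain]
        exact h2.2 j hj
      · exact absurd hj (not_linked_plain_bar _ _ _ _)
    · intro h2 j hj
      rw [← hl] at hj
      rcases plain_or_bar j with ⟨j, rfl⟩ | ⟨j, rfl⟩
      · rw [linked_plain_plain] at hj
        rw [plain_le_plain, plain_le_plain]
        exact h2 j hj
      · exact absurd hj (not_linked_plain_bar _ _ _ _)
  · rw [double_bar]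
    obtain ⟨h1, h2⟩ := h.isNext_right i
    refine ⟨by rwa [← hl, linked_bar_bar], h2.imp (fun h2 => ⟨?_, ?_⟩) ?_⟩
    · rw [bar_lt_bar]
      exact h2.1
    · intro j hj
      rw [← hl] at hj
      rcases plain_or_bar j with ⟨j, rfl⟩ | ⟨j, rfl⟩
      · exact absurd hj (not_linked_bar_plain _ _ _ _)
      · rw [linked_bar_bar] at hj
        rw [bar_lt_bar, bar_le_bar]
        exact h2.2 j hj
    · intro h2 j hj
      rw [← hl] at hj
      rcases plain_or_bar j with ⟨j, rfl⟩ | ⟨j, rfl⟩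
      · exact absurd hj (not_linked_bar_plain _ _ _ _)
      · rw [linked_bar_bar] at hj
        rw [bar_le_bar, bar_le_bar]
        exact h2 j hj

theorem Planar.card_tops (hm : 0 < m) (h : Planar p q s t) :
    (univ.filter fun d => double s t d ≤ d).card = m + 1 := by
  rw [← (orbitFamily_blocksUnion h.left h.right).card_eq h.isNext_double, card_blocksUnion,
    h.card_add_card hm]

variable (u : Perm (Doubled m))

/-- `plain i` and `bar i` are adjacent in the doubled order. This lemma and the next three provide
the telescoping in `leftLift_mul_rightLift`. -/
theorem hi_plain (i : Fin m) : hi u (plain i) = lo u (bar i) := by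
  unfold hi lo
  congr 1
  ext d
  simp only [mem_filter, mem_univ, true_and]
  refine and_congr_right fun _ => ?_
  rcases plain_or_bar d with ⟨j, rfl⟩ | ⟨j, rfl⟩
  · rw [← not_lt, plain_lt_plain, plain_lt_bar, not_lt]
  · rw [← not_lt, plain_lt_bar, bar_lt_bar, not_le]

theorem hi_bar (i j : Fin m) (h : i.val + 1 = j.val) : hi u (bar i) = lo u (plain j) := by
  unfold hi lo
  congr 1
  ext d
  simp only [mem_filter, mem_univ, true_and]
  refine and_congr_right fun _ => ?_
  rcases plain_or_bar d with ⟨l, rfl⟩ | ⟨l, rfl⟩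
  · rw [← not_lt, bar_lt_plain, plain_lt_plain, Fin.lt_def, Fin.lt_def]
    omega
  · rw [← not_lt, bar_lt_bar, bar_lt_plain, Fin.lt_def, Fin.lt_def]
    omega

theorem lo_plain_zero (i : Fin m) (h : i.val = 0) : lo u (plain i) = 0 := by
  rw [lo, card_eq_zero, filter_eq_empty_iff]
  rintro d - ⟨-, hd⟩
  rcases plain_or_bar d with ⟨l, rfl⟩ | ⟨l, rfl⟩
  · rw [plain_lt_plain, Fin.lt_def] at hd
    omega
  · rw [bar_lt_plain, Fin.lt_def] at hd
    omega

theorem hi_bar_last (i : Fin m) (h : i.val + 1 = m) :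
    hi u (bar i) = (univ.filter fun d => u d ≤ d).card := by
  unfold hi
  congr 1
  ext d
  simp only [mem_filter, mem_univ, true_and, and_iff_left_iff_imp]
  intro _
  rcases plain_or_bar d with ⟨l, rfl⟩ | ⟨l, rfl⟩
  · rw [← not_lt, bar_lt_plain, Fin.lt_def]
    omega
  · rw [← not_lt, bar_lt_bar, Fin.lt_def]
    omega

end Double

/-! ### Lifts to `[(k+1)n]` parametrised by partial monodromies. -/

section Lift

variable {k n : ℕ}

/-- The lift to `[(k+1)n]` of a permutation of `[n]` acting through `g` on the fibres. -/
def liftPerm (g : Fin n → Perm (Fin (k + 1))) (s : Perm (Fin n)) : Perm (Fin ((k + 1) * n)) :=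
  finProdFinEquiv.permCongr (shear g s)

theorem liftPerm_apply (g : Fin n → Perm (Fin (k + 1))) (s : Perm (Fin n)) (a : Fin (k + 1))
    (i : Fin n) : liftPerm g s (finProdFinEquiv (a, i)) = finProdFinEquiv (g i a, s i) := by
  simp [liftPerm]

theorem red_liftPerm (g : Fin n → Perm (Fin (k + 1))) (s : Perm (Fin n))
    (x : Fin ((k + 1) * n)) : red k n (liftPerm g s x) = s (red k n x) := by
  obtain ⟨⟨a, i⟩, rfl⟩ := finProdFinEquiv.surjective x
  rw [liftPerm_apply, red_finProdFinEquiv, red_finProdFinEquiv]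

theorem liftPerm_injective (s : Perm (Fin n)) :
    Function.Injective fun g : Fin n → Perm (Fin (k + 1)) => liftPerm g s := by
  intro g g' h
  funext i
  ext1 a
  have h1 := Equiv.congr_fun h (finProdFinEquiv (a, i))
  simp only [liftPerm_apply, EmbeddingLike.apply_eq_iff_eq, Prod.mk.injEq] at h1
  exact h1.1

theorem exists_liftPerm {σ : Perm (Fin ((k + 1) * n))} {s : Perm (Fin n)}
    (h : ∀ x, red k n (σ x) = s (red k n x)) : ∃ g, liftPerm g s = σ := by
  have hσ : ∀ a i, σ (finProdFinEquiv (a, i)) =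
      finProdFinEquiv ((finProdFinEquiv.symm (σ (finProdFinEquiv (a, i)))).1, s i) := by
    intro a i
    apply finProdFinEquiv.symm.injective
    rw [symm_apply_apply]
    refine Prod.ext rfl ?_
    rw [finProdFinEquiv_symm_snd, h, red_finProdFinEquiv]
  have hinj : ∀ i, Function.Injective fun a : Fin (k + 1) =>
      (finProdFinEquiv.symm (σ (finProdFinEquiv (a, i)))).1 := by
    intro i a b hab
    have h1 : σ (finProdFinEquiv (a, i)) = σ (finProdFinEquiv (b, i)) := by
      rw [hσ a i, hσ b i]
      exact congrArg (fun c => finProdFinEquiv (c, s i)) hab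
    simpa using h1
  refine ⟨fun i => ofBijective _ (Finite.injective_iff_bijective.1 (hinj i)), ?_⟩
  ext1 x
  obtain ⟨⟨a, i⟩, rfl⟩ := finProdFinEquiv.surjective x
  rw [liftPerm_apply, hσ a i]
  rfl

/-- The big rotation changes sheet only when the residue wraps around; this makes the long cycle of
`[k+1]` the total monodromy. -/
theorem finRotate_finProdFinEquiv (a : Fin (k + 1)) (i : Fin n) :
    finRotate ((k + 1) * n) (finProdFinEquiv (a, i)) =
      finProdFinEquiv (if i.val + 1 = n then finRotate (k + 1) a else a, finRotate n i) := by
  have hi := i.isLt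
  have ha := a.isLt
  have hle : n * (a.val + 1) ≤ (k + 1) * n := by
    rw [mul_comm]
    exact Nat.mul_le_mul_right n ha
  have hmul : n * (a.val + 1) = n * a.val + n := by ring
  have hval : ∀ (a : Fin (k + 1)) (i : Fin n), (finProdFinEquiv (a, i)).val = i + n * a :=
    fun _ _ => rfl
  have h1 := finRotate_val (finProdFinEquiv (a, i))
  have h2 := finRotate_val i
  have h3 := finRotate_val a
  have h4 := hval a i
  ext
  rw [hval]
  by_cases h : i.val + 1 = n
  · rw [if_pos h] at h2 ⊢
    by_cases h' : a.val + 1 = k + 1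
    · have : n * (a.val + 1) = (k + 1) * n := by rw [h', mul_comm]
      rw [if_pos h'] at h3
      rw [if_pos (by omega)] at h1
      rw [h1, h2, h3]
      simp
    · have : n * (a.val + 1) ≠ (k + 1) * n := by
        rw [mul_comm]
        exact fun hh => h' (Nat.eq_of_mul_eq_mul_right (by omega) hh)
      rw [if_neg h'] at h3
      rw [if_neg (by omega)] at h1
      rw [h1, h2, h3]
      omega
  · rw [if_neg h] at h2 ⊢
    rw [if_neg (by omega)] at h1
    omega

/-- The identification of the fibres of the reduction with `[k+1]`. -/
def sheet (k n : ℕ) : Fin (k + 1) × Doubled n ≃ Doubled ((k + 1) * n) where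
  toFun z := toLex (finProdFinEquiv (z.1, (ofLex z.2).1), (ofLex z.2).2)
  invFun w := ((finProdFinEquiv.symm (ofLex w).1).1, redDoubled k n w)
  left_inv z := by
    obtain ⟨a, d⟩ := z
    simp [redDoubled, red_finProdFinEquiv]
  right_inv w := by
    have h : finProdFinEquiv ((finProdFinEquiv.symm (ofLex w).1).1, red k n (ofLex w).1) =
        (ofLex w).1 := finProdFinEquiv.apply_symm_apply (ofLex w).1
    simp only [redDoubled, ofLex_toLex, h]
    rfl

theorem sheet_plain (a : Fin (k + 1)) (i : Fin n) :
    sheet k n (a, plain i) = plain (finProdFinEquiv (a, i)) := rfl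

theorem sheet_bar (a : Fin (k + 1)) (i : Fin n) :
    sheet k n (a, bar i) = bar (finProdFinEquiv (a, i)) := rfl

theorem redDoubled_sheet (z : Fin (k + 1) × Doubled n) : redDoubled k n (sheet k n z) = z.2 :=
  congrArg Prod.snd ((sheet k n).symm_apply_apply z)

theorem redDoubled_surjective : Function.Surjective (redDoubled k n) := fun d =>
  ⟨sheet k n (0, d), redDoubled_sheet _⟩

/-- The partial monodromies: `1`, then the given permutations, then the monodromy at infinity. -/
def monodromy (Q : Fin n → Perm (Fin (k + 1))) (j : ℕ) : Perm (Fin (k + 1)) :=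
  if j = 0 then 1 else if h : j - 1 < n then Q ⟨j - 1, h⟩ else finRotate (k + 1)

theorem monodromy_zero (Q : Fin n → Perm (Fin (k + 1))) : monodromy Q 0 = 1 := rfl

theorem monodromy_last (Q : Fin n → Perm (Fin (k + 1))) :
    monodromy Q (n + 1) = finRotate (k + 1) := by
  simp [monodromy]

theorem monodromy_succ (Q : Fin n → Perm (Fin (k + 1))) (i : Fin n) :
    monodromy Q (i + 1) = Q i := by
  simp [monodromy]

variable (s t : Perm (Fin n)) (Q : Fin n → Perm (Fin (k + 1)))

/-- The lift of `s` with partial monodromies `Q`. -/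
def leftLift : Perm (Fin ((k + 1) * n)) :=
  liftPerm (fun i => transition (double s t) (monodromy Q) (plain i)) s

/-- The lift of `t` with partial monodromies `Q`. -/
def rightLift : Perm (Fin ((k + 1) * n)) :=
  liftPerm (fun i => transition (double s t) (monodromy Q) (bar i)) t

theorem double_leftLift_sheet (z : Fin (k + 1) × Doubled n) :
    double (leftLift s t Q) (rightLift s t Q) (sheet k n z) =
      sheet k n (shear (transition (double s t) (monodromy Q)) (double s t) z) := by
  obtain ⟨a, d⟩ := z
  rcases plain_or_bar d with ⟨i, rfl⟩ | ⟨i, rfl⟩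
  · simp only [shear_apply, sheet_plain, double_plain, leftLift, liftPerm_apply]
  · simp only [shear_apply, sheet_bar, double_bar, rightLift, liftPerm_apply]

theorem sameCycle_sheet_iff (z w : Fin (k + 1) × Doubled n) :
    (double (leftLift s t Q) (rightLift s t Q)).SameCycle (sheet k n z) (sheet k n w) ↔
      (shear (transition (double s t) (monodromy Q)) (double s t)).SameCycle z w := by
  constructor
  · intro h
    have := sameCycle_map (r := (sheet k n).symm)
      (s := shear (transition (double s t) (monodromy Q)) (double s t)) (fun x => ?_) h
    · simpa using this
    · obtain ⟨z, rfl⟩ := (sheet k n).surjective x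
      rw [double_leftLift_sheet, symm_apply_apply, symm_apply_apply]
  · exact sameCycle_map fun z => (double_leftLift_sheet s t Q z).symm

theorem redDoubled_double_leftLift (w : Doubled ((k + 1) * n)) :
    redDoubled k n (double (leftLift s t Q) (rightLift s t Q) w) =
      double s t (redDoubled k n w) := by
  obtain ⟨z, rfl⟩ := (sheet k n).surjective w
  rw [double_leftLift_sheet, redDoubled_sheet, redDoubled_sheet, shear_apply]

variable {s t}

/-- The transitions at `bar i` and `plain (t i)` telescope to `(P (lo (plain (i + 1))))⁻¹ * P (hi
(bar i))`. This is trivial except at the last `i`, where it is `(P 0)⁻¹ * P (n + 1)`, the long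
cycle. -/
theorem leftLift_mul_rightLift {p q : Part n} (h : Planar p q s t) :
    leftLift s t Q * rightLift s t Q = finRotate ((k + 1) * n) := by
  ext1 x
  obtain ⟨⟨a, i⟩, rfl⟩ := finProdFinEquiv.surjective x
  rw [Perm.mul_apply, rightLift, liftPerm_apply, leftLift, liftPerm_apply,
    finRotate_finProdFinEquiv, h.apply_apply]
  congr 2
  simp only [transition, double_plain, double_bar, h.apply_apply, hi_plain, Perm.mul_apply]
  have hr := finRotate_val i
  by_cases hi : i.val + 1 = n
  · rw [if_pos hi] at hr ⊢
    have hn : 0 < n := by omega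
    rw [lo_plain_zero _ _ hr, hi_bar_last _ _ hi, h.card_tops hn, monodromy_last, monodromy_zero]
    simp
  · rw [if_neg hi] at hr ⊢
    rw [hi_bar _ i _ hr.symm]
    simp

theorem leftLift_injective {p q : Part n} (hn : 0 < n) (h : Planar p q s t) :
    Function.Injective (leftLift (k := k) s t) := by
  intro Q Q' hQ
  have hr : rightLift s t Q = rightLift s t Q' := by
    have h1 := (leftLift_mul_rightLift Q h).trans (leftLift_mul_rightLift Q' h).symm
    rw [hQ] at h1
    exact mul_left_cancel h1
  have htr : ∀ d, transition (double s t) (monodromy Q) d =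
      transition (double s t) (monodromy Q') d := by
    intro d
    rcases plain_or_bar d with ⟨i, rfl⟩ | ⟨i, rfl⟩
    · exact congrFun (liftPerm_injective s hQ) i
    · exact congrFun (liftPerm_injective t hr) i
  -- At the top `d` of block `j`, the transition expresses `P (j + 1)` through `P (lo (u d))`, and
  -- `lo (u d) ≤ j` is covered by induction.
  have key : ∀ j, j ≤ n + 1 → monodromy Q j = monodromy Q' j := by
    intro j
    induction j using Nat.strong_induction_on with
    | _ j ih =>
      intro hj
      obtain _ | j := j
      · rfl
      · obtain ⟨d, hd, hdj⟩ := exists_lo_eq (u := double s t) (j := j)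
          (by rw [h.card_tops hn]; omega)
        have h1 := htr d
        have h2 : lo (double s t) (double s t d) ≤ j := hdj ▸ lo_mono hd
        rw [transition, transition, hi_eq_lo_add_one hd, hdj, ih _ (by omega) (by omega)] at h1
        exact mul_left_cancel h1
  funext i
  rw [← monodromy_succ Q, ← monodromy_succ Q', key _ (by omega)]

/-- Partial monodromies and fibre permutations of lifts of `s` both range over the finite type `Fin
n → Perm (Fin (k + 1))`, so injectivity suffices. -/
theorem exists_leftLift {p q : Part n} (hn : 0 < n) (h : Planar p q s t)
    {σ : Perm (Fin ((k + 1) * n))} (hσ : ∀ x, red k n (σ x) = s (red k n x)) :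
    ∃ Q, leftLift s t Q = σ := by
  obtain ⟨g, rfl⟩ := exists_liftPerm hσ
  have hinj : Function.Injective fun (Q : Fin n → Perm (Fin (k + 1))) (i : Fin n) =>
      transition (double s t) (monodromy Q) (plain i) := fun Q Q' hQ =>
    leftLift_injective hn h (congrArg (fun g => liftPerm g s) hQ)
  obtain ⟨Q, rfl⟩ := Finite.injective_iff_surjective.1 hinj g
  exact ⟨Q, rfl⟩

end Lift

/-! ### Shapes as orbit counts, and the bijection. -/

section

variable {k n : ℕ} {p q : Part n} {s t : Perm (Fin n)}

/-- The number of orbits of the `j`-th local monodromy. -/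
noncomputable def localOrbitCount (Q : Fin n → Perm (Fin (k + 1))) (j : ℕ) : ℕ :=
  orbitCount (monodromy Q (j + 1) * (monodromy Q j)⁻¹)

/-- Every block over `M` meets the fibre over the top `d`, and two points of that fibre share a
block exactly when their flat coordinates share an orbit of the local monodromy. -/
theorem card_filter_image_redDoubled (h : Planar p q s t) (Q : Fin n → Perm (Fin (k + 1)))
    {G : Finset (Finset (Doubled ((k + 1) * n)))}
    (hG : OrbitFamily G (double (leftLift s t Q) (rightLift s t Q))) {M : Finset (Doubled n)}
    (hM : M ∈ blocksUnion p q) {d : Doubled n} (hd : d ∈ M) (hdt : double s t d ≤ d) :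
    (G.filter fun V => V.image (redDoubled k n) = M).card =
      localOrbitCount Q (lo (double s t) d) := by
  have hF := orbitFamily_blocksUnion h.left h.right
  choose b hbG hmem using hG.exists_mem
  set f : Fin (k + 1) → Finset (Doubled ((k + 1) * n)) := fun y =>
    b (sheet k n ((monodromy Q (lo (double s t) d))⁻¹ y, d)) with hf
  have hb : ∀ V ∈ G, ∀ w ∈ V, b w = V := fun V hV w hw => hG.eq_of_mem (hbG w) hV (hmem w) hw
  have hker : ∀ y y', f y = f y' ↔ (monodromy Q (lo (double s t) d + 1) *
      (monodromy Q (lo (double s t) d))⁻¹).SameCycle y y' := by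
    intro y y'
    rw [← sameCycle_shear_iff h.isNext_double hdt, ← sameCycle_sheet_iff,
      ← hG.mem_iff _ (hbG _) _ (hmem _)]
    constructor
    · intro hyy
      have : f y = b (sheet k n ((monodromy Q (lo (double s t) d))⁻¹ y, d)) := rfl
      rw [← this, hyy]
      exact hmem _
    · intro hmem'
      exact (hb _ (hbG _) _ hmem').symm
  have hrange : Set.range f = (G.filter fun V => V.image (redDoubled k n) = M : Finset _) := by
    ext V
    simp only [Set.mem_range, coe_filter, Set.mem_ofPred_eq]
    constructor
    · rintro ⟨y, rfl⟩
      refine ⟨hbG _, hG.image_eq hF (redDoubled_double_leftLift s t Q) (hbG _) hM (hmem _) ?_⟩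
      rwa [redDoubled_sheet]
    · rintro ⟨hV, rfl⟩
      obtain ⟨w, hw, hwd⟩ := mem_image.1 hd
      obtain ⟨⟨a, e⟩, rfl⟩ := (sheet k n).surjective w
      rw [redDoubled_sheet] at hwd
      simp only at hwd
      subst hwd
      refine ⟨monodromy Q (lo (double s t) e) a, ?_⟩
      have h1 : f (monodromy Q (lo (double s t) e) a) = b (sheet k n (a, e)) := by simp [hf]
      rw [h1, hb V hV _ hw]
  have hsetoid : Setoid.ker f = Perm.SameCycle.setoid (monodromy Q (lo (double s t) d + 1) *
      (monodromy Q (lo (double s t) d))⁻¹) := Setoid.ext hker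
  rw [localOrbitCount, orbitCount, ← hsetoid,
    Nat.card_congr (Setoid.quotientKerEquivRange f), hrange]
  simp

theorem sum_card_filter_image_redDoubled {G : Finset (Finset (Doubled ((k + 1) * n)))}
    (h : Planar p q s t) (Q : Fin n → Perm (Fin (k + 1)))
    (hG : OrbitFamily G (double (leftLift s t Q) (rightLift s t Q))) {M : Finset (Doubled n)}
    (hM : M ∈ blocksUnion p q) :
    ∑ V ∈ G.filter (fun V => V.image (redDoubled k n) = M), V.card = (k + 1) * M.card := by
  have hF := orbitFamily_blocksUnion h.left h.right
  rw [← card_biUnion]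
  · have : (G.filter fun V => V.image (redDoubled k n) = M).biUnion id =
        (univ ×ˢ M).image (sheet k n) := by
      ext w
      simp only [mem_biUnion, mem_filter, id, mem_image, mem_product, mem_univ, true_and]
      constructor
      · rintro ⟨V, ⟨hV, rfl⟩, hw⟩
        obtain ⟨z, rfl⟩ := (sheet k n).surjective w
        refine ⟨z, ?_, rfl⟩
        have := mem_image_of_mem (redDoubled k n) hw
        rwa [redDoubled_sheet] at this
      · rintro ⟨z, hz, rfl⟩
        obtain ⟨V, hV, hw⟩ := hG.exists_mem (sheet k n z)
        refine ⟨V, ⟨hV, ?_⟩, hw⟩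
        refine hG.image_eq hF (redDoubled_double_leftLift s t Q) hV hM hw ?_
        rwa [redDoubled_sheet]
    have h' := congrArg card this
    rw [card_image_of_injective _ (sheet k n).injective, card_product, card_univ,
      Fintype.card_fin] at h'
    exact h'
  · intro V hV W hW hVW
    rw [Function.onFun, disjoint_left]
    intro w hw hw'
    exact hVW (hG.eq_of_mem (mem_filter.1 hV).1 (mem_filter.1 hW).1 hw hw')

theorem exists_block_lo_eq (hn : 0 < n) (h : Planar p q s t) (j : Fin (n + 1)) :
    ∃ M ∈ blocksUnion p q, ∃ d ∈ M, double s t d ≤ d ∧ lo (double s t) d = j := by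
  obtain ⟨d, hd, hj⟩ := exists_lo_eq (u := double s t) (j := j) (by
    rw [h.card_tops hn]
    exact j.isLt)
  obtain ⟨M, hM, hdM⟩ := (orbitFamily_blocksUnion h.left h.right).exists_mem d
  exact ⟨M, hM, d, hdM, hd, hj⟩

/-- The blocks over `M` cover it `k + 1` times, so their multiplicities sum to `k + 1`; each block
then subtracts `1`. -/
theorem shape_eq (hn : 0 < n) {π : NCType k n} (h : Planar p q s t)
    (hpq : NonCrossing (blocksUnion p q)) (Q : Fin n → Perm (Fin (k + 1)))
    (hG : OrbitFamily (mixBlocks π.1) (double (leftLift s t Q) (rightLift s t Q)))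
    (j : Fin (n + 1)) : shape π j = (k + 1) - localOrbitCount Q j := by
  classical
  have hF := orbitFamily_blocksUnion h.left h.right
  obtain ⟨M, hM, d, hd, hdt, hj⟩ := exists_block_lo_eq hn h j
  have himage : (mixBlocks π.1).image (Finset.image (redDoubled k n)) = blocksUnion p q :=
    hG.image_image_eq hF (redDoubled_double_leftLift s t Q) redDoubled_surjective
  have hfilter : (mixBlocks π.1).filter (fun V =>
      IsNthBlock ((mixBlocks π.1).image (Finset.image (redDoubled k n))) j
        (V.image (redDoubled k n))) =
      (mixBlocks π.1).filter fun V => V.image (redDoubled k n) = M := by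
    refine filter_congr fun V hV => ?_
    rw [himage]
    have hVF : V.image (redDoubled k n) ∈ blocksUnion p q := himage ▸ mem_image_of_mem _ hV
    obtain ⟨e, he, het⟩ := hF.exists_top h.isNext_double hVF
    rw [hF.isNthBlock_iff hpq h.isNext_double hVF he het]
    constructor
    · intro hlo
      have hed := lo_injOn het hdt (hlo.trans hj.symm)
      exact hF.eq_of_mem hVF hM he (hed ▸ hd)
    · intro hVM
      have hed := eq_of_sameCycle_of_apply_le h.isNext_double het hdt
        ((hF.mem_iff _ hM e (hVM ▸ he) d).1 hd)
      rw [hed, hj]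
  have hM0 : (M.card : ℚ) ≠ 0 := by
    exact_mod_cast (card_pos.2 ⟨d, hd⟩).ne'
  have hsum := sum_card_filter_image_redDoubled h Q hG hM
  have hcard := card_filter_image_redDoubled h Q hG hM hd hdt
  have hmult : ∀ V ∈ (mixBlocks π.1).filter (fun V => V.image (redDoubled k n) = M),
      mult V - 1 = (V.card : ℚ) / M.card - 1 := fun V hV => by
    rw [mult, (mem_filter.1 hV).2]
  have hshape : shape π j = ∑ V ∈ (mixBlocks π.1).filter (fun V =>
      IsNthBlock ((mixBlocks π.1).image (Finset.image (redDoubled k n))) j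
        (V.image (redDoubled k n))), (mult V - 1) := by
    unfold shape
    congr!
  rw [hshape, hfilter, sum_congr rfl hmult, sum_sub_distrib, ← sum_div, ← Nat.cast_sum, hsum,
    sum_const, hcard, hj]
  push_cast
  rw [mul_div_cancel_right₀ _ hM0]
  simp

theorem sum_localOrbitCount_le (hn : 0 < n) (h : Planar p q s t)
    (Q : Fin n → Perm (Fin (k + 1))) {G : Finset (Finset (Doubled ((k + 1) * n)))}
    (hG : OrbitFamily G (double (leftLift s t Q) (rightLift s t Q))) :
    ∑ j : Fin (n + 1), localOrbitCount Q j ≤ G.card := by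
  classical
  choose M hM d hd hdt hj using exists_block_lo_eq hn h
  have h1 : ∀ j : Fin (n + 1), localOrbitCount Q j =
      (G.filter fun V => V.image (redDoubled k n) = M j).card := fun j => by
    rw [card_filter_image_redDoubled h Q hG (hM j) (hd j) (hdt j), hj]
  rw [sum_congr rfl fun j _ => h1 j, ← card_biUnion]
  · exact card_le_card (biUnion_subset.2 fun j _ => filter_subset _ _)
  · intro i _ j _ hij
    rw [Function.onFun, disjoint_left]
    intro V hV hV'
    have hMM : M i = M j := (mem_filter.1 hV).2.symm.trans (mem_filter.1 hV').2
    have hF := orbitFamily_blocksUnion h.left h.right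
    have hdd := eq_of_sameCycle_of_apply_le h.isNext_double (hdt i) (hdt j)
      ((hF.mem_iff _ (hM j) (d i) (hMM ▸ hd i) (d j)).1 (hd j))
    exact hij (Fin.ext (by rw [← hj i, ← hj j, hdd]))

/-- The monodromy data whose local monodromies have the ranks prescribed by `l`. -/
def monodromySet (k n : ℕ) (l : Fin (n + 1) → ℕ) : Set (Fin n → Perm (Fin (k + 1))) :=
  {Q | ∀ j : Fin (n + 1), localOrbitCount Q j + l j = k + 1}

/-- The bijection sends `π` to the partial monodromies of its successor permutation, viewed as a
lift of `s`. Only the bijection depends on `p`, not its target. -/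
theorem ncard_withShapeAndReduction (hn : 0 < n) {l : Fin (n + 1) → ℕ} (hl : l ∈ Lam (n + 1) k)
    (p : NC n) : (withShapeAndReduction (k := k) l p).ncard = (monodromySet k n l).ncard := by
  obtain ⟨s, t, h⟩ := exists_planar p
  have hpq := (kreweras_isGreatest p).1
  have hkr : NonCrossing (kreweras p).parts := by
    intro a b c d hab hbc hcd hac hbd
    rw [← linked_bar_bar p.1]
    exact hpq (bar a) (bar b) (bar c) (bar d) ((bar_lt_bar _ _).2 hab) ((bar_lt_bar _ _).2 hbc)
      ((bar_lt_bar _ _).2 hcd) ((linked_bar_bar _ _ _ _).2 hac) ((linked_bar_bar _ _ _ _).2 hbd)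
  have hshape : ∀ (π : NCType k n) (Q : Fin n → Perm (Fin (k + 1))),
      Planar π.1.1 (kreweras π.1) (leftLift s t Q) (rightLift s t Q) →
      ((∀ j, shape π j = (l j : ℚ)) ↔ Q ∈ monodromySet k n l) := by
    intro π Q hπ
    refine forall_congr' fun j => ?_
    rw [shape_eq hn h hpq Q (orbitFamily_blocksUnion hπ.left hπ.right) j, sub_eq_iff_eq_add']
    constructor
    · intro h1
      exact_mod_cast h1.symm
    · intro h1
      exact_mod_cast h1.symm
  have hex : ∀ π ∈ withShapeAndReduction (k := k) l p, ∃ Q ∈ monodromySet k n l,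
      Planar π.1.1 (kreweras π.1) (leftLift s t Q) (rightLift s t Q) := by
    rintro π ⟨hsh, hred⟩
    obtain ⟨σ, τ, hπ⟩ := exists_planar π.1
    obtain ⟨q', hq'⟩ := π.2.2
    obtain ⟨Q, rfl⟩ := exists_leftLift hn h (red_perm_apply hπ h hred hq'.symm)
    have hτ : τ = rightLift s t Q :=
      mul_left_cancel (hπ.mul.trans (leftLift_mul_rightLift Q h).symm)
    subst hτ
    exact ⟨Q, (hshape π Q hπ).1 hsh, hπ⟩
  choose f hf hplanar using hex
  refine Set.ncard_congr f hf (fun π π' hπ hπ' heq => ?_) fun Q hQ => ?_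
  · have h1 := hplanar π hπ
    have h2 := hplanar π' hπ'
    rw [heq] at h1
    exact Subtype.ext (Subtype.ext (part_ext fun i j => (h1.left i j).trans (h2.left i j).symm))
  · obtain ⟨π₁, h₁⟩ := exists_orbit_partition (leftLift s t Q)
    obtain ⟨π₂, h₂⟩ := exists_orbit_partition (rightLift s t Q)
    -- The orbit counts sum to `(n + 1) * (k + 1) - k = (k + 1) * n + 1`, exactly what
    -- `planar_of_card` needs; this is where the sum of `l` being `k` enters.
    have hcard : (k + 1) * n + 1 ≤ π₁.parts.card + π₂.parts.card := by
      have h3 := sum_localOrbitCount_le hn h Q (orbitFamily_blocksUnion h₁ h₂)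
      rw [card_blocksUnion] at h3
      have h4 : ∑ j : Fin (n + 1), (localOrbitCount Q j + l j) = (n + 1) * (k + 1) := by
        rw [sum_congr rfl fun j _ => hQ j]
        simp
      have h5 : ∑ j, l j = k := hl
      rw [sum_add_distrib, h5] at h4
      have h6 : (n + 1) * (k + 1) = (k + 1) * n + 1 + k := by ring
      omega
    have hπ := planar_of_card (leftLift_mul_rightLift Q h) h₁ h₂ hcard
    set ρ : NC ((k + 1) * n) := ⟨π₁, hπ.nonCrossing⟩ with hρ
    have hρπ : Planar ρ.1 π₂ (leftLift s t Q) (rightLift s t Q) := hπ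
    have hkρ : π₂ = kreweras ρ := hρπ.kreweras_eq
    have hred₁ : redBlocks k n ρ.1 = p.1.parts :=
      (orbitFamily_parts h₁).image_image_eq (orbitFamily_parts h.left) (red_liftPerm _ _)
        red_surjective
    have hred₂ : redBlocks k n π₂ = (kreweras p).parts :=
      (orbitFamily_parts h₂).image_image_eq (orbitFamily_parts h.right) (red_liftPerm _ _)
        red_surjective
    rw [hkρ] at hρπ hred₂
    set π : NCType k n := ⟨ρ, ⟨p, hred₁.symm⟩, ⟨⟨kreweras p, hkr⟩, hred₂.symm⟩⟩
    have hmem : π ∈ withShapeAndReduction (k := k) l p := ⟨(hshape π Q hρπ).2 hQ, hred₁⟩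
    exact ⟨π, hmem, leftLift_injective hn h ((hplanar π hmem).perm_eq hρπ).1⟩

end

end NonCrossingTypeK

theorem mainTheorem11 (n k : ℕ) (hn : 1 ≤ n) (l : Fin (n + 1) → ℕ)
    (hl : l ∈ NonCrossingTypeK.Lam (n + 1) k) :
    ∃ r : ℕ, ∀ p : NonCrossingTypeK.NC n,
      (NonCrossingTypeK.withShapeAndReduction (k := k) l p).Finite ∧
      (NonCrossingTypeK.withShapeAndReduction (k := k) l p).ncard = r := by
  refine ⟨(NonCrossingTypeK.monodromySet k n l).ncard, fun p =>
    ⟨?_, NonCrossingTypeK.ncard_withShapeAndReduction hn hl p⟩⟩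
  have : Finite (NonCrossingTypeK.NC ((k + 1) * n)) :=
    inferInstanceAs (Finite {p : NonCrossingTypeK.Part _ // _})
  have : Finite (NonCrossingTypeK.NCType k n) :=
    inferInstanceAs (Finite {π : NonCrossingTypeK.NC ((k + 1) * n) // _})
  exact Set.toFinite _
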